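/- Proposition (Prop:Symbolic). Let $X$ be a (connected) complex projective manifold, $\Sigma\subset X$ a hypersurface, $Y=X\setminus\Sigma$, and let $s\ge 1$. Let $U_1,\dots,U_d:X\to\mathbf P^1$ be holomorphic maps whose restrictions to $Y$ are submersions and such that $dU_i$ and $dU_j$ are linearly independent at every point of $Y$ for all $i\ne j$ (so that the $U_i$ define a web by hypersurfaces on $Y$). Assume that for every $i$ the set $\mathfrak B_i=\mathbf P^1\setminus U_i(Y)$ contains $\infty$ and has exactly $s+1$ elements. For each $i$, let $\widetilde H_i=H^0\big(\mathbf P^1,\Omega^1_{\mathbf P^1}(\mathrm{Log}\,\mathfrak B_i)\big)$ be the $s$-dimensional space of logarithmic 1-forms on $\mathbf P^1$ with poles in $\mathfrak B_i$, let $(\tilde\nu^i_1,\dots,\tilde\nu^i_s)$ be a basis of it, and set $$\widetilde\Omega_i=\frac1{s!}\sum_{\sigma\in\mathfrak S_s}\epsilon(\sigma)\,\tilde\nu^i_{\sigma(1)}\otimes\cdots\otimes\tilde\nu^i_{\sigma(s)}\in\widetilde H_i^{\otimes s}.$$ Let $H=\sum_{i=1}^d U_i^*(\widetilde H_i)$,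 a space of holomorphic 1-forms on $Y$, and let $\Omega_i=U_i^*(\widetilde\Omega_i)\in\wedge^sH\subset H^{\otimes s}$. For $x\in\mathbf P^1\setminus\mathfrak B_i$, let $AI^s_{i,x}$ be the holomorphic germ at $x$ obtained by applying to $\widetilde\Omega_i$ the linear map which sends $\omega_1\otimes\cdots\otimes\omega_s\in \widetilde H_i^{\otimes s}$ to the germ of the iterated integral $$z\longmapsto\int_x^z\omega_1(t_1)\int_x^{t_1}\omega_2(t_2)\cdots\int_x^{t_{s-1}}\omega_s(t_s)$$ along the straight path from $x$ to $z$ (for $z$ close to $x$). For $y\in Y$ write $y_i=U_i(y)$. Then, for any $(c_i)_{i=1}^d\in\mathbf C^d$, the following conditions are equivalent: 1. $\sum_{i=1}^d c_i\,\Omega_i=0$ in $\wedge^sH\subset H^{\otimes s}$; 2. there exists $y\in Y$ such that $\sum_{i=1}^d c_i\,AI^s_{i,y_i}(U_i)=0$ as a holomorphic germ at $y$; 3. for every $y\in Y$, one has $\sum_{i=1}^d c_i\,AI^s_{i,y_i}(U_i)=0$ as a holomorphic germ at $y$. -/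

import Mathlib

open scoped Manifold ContDiff TensorProduct Topology

noncomputable section

namespace HyperlogWeb

/-! ### The projective line and holomorphic maps to projective spaces -/

/-- Complex projective space of dimension `N`. -/
abbrev ProjSpace (N : ℕ) : Type := Projectivization ℂ (Fin (N + 1) → ℂ)

/-- The inclusion `t ↦ [t : 1]` of the affine line in the projective line. -/
def ofAffine (t : ℂ) : ProjSpace 1 :=
  Projectivization.mk ℂ ![t, 1] (fun h => one_ne_zero (congrFun h 1))

/-- The point `∞ = [1 : 0]` of the projective line. -/
def infPt : ProjSpace 1 :=
  Projectivization.mk ℂ ![1, 0] (fun h => one_ne_zero (congrFun h 0))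

/-- The affine coordinate `[a : b] ↦ a / b` on the projective line (only meaningful away
from `∞`, where it takes the value `0` by convention). -/
def affCoord : ProjSpace 1 → ℂ :=
  Projectivization.lift (fun v => v.1 0 / v.1 1) (by
    rintro ⟨a, ha⟩ ⟨b, hb⟩ t h
    have ht : t ≠ 0 := by
      rintro rfl
      exact ha (by simpa using h)
    simp only at h
    subst h
    simp [mul_div_mul_left _ _ ht])

lemma affCoord_ofAffine (t : ℂ) : affCoord (ofAffine t) = t := by
  simp [affCoord, ofAffine]

section Manifold

variable {E : Type*} [NormedAddCommGroup E] [NormedSpace ℂ E]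
  {X : Type*} [TopologicalSpace X] [ChartedSpace E X]

/-- `F` is a holomorphic lift near `x` of the map `g` to projective space:
`g = [F 0 : ... : F N]` near `x`, with `F` holomorphic and without zero. -/
def IsHolomorphicLiftAt {N : ℕ} (g : X → ProjSpace N) (F : X → Fin (N + 1) → ℂ) (x : X) : Prop :=
  ContMDiffAt 𝓘(ℂ, E) 𝓘(ℂ, Fin (N + 1) → ℂ) ω F x ∧
    ∀ᶠ x' in 𝓝 x, ∃ h : F x' ≠ 0, g x' = Projectivization.mk ℂ (F x') h

variable (E) in
/-- Holomorphic maps from a complex manifold to projective space. -/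
def IsHolomorphicToProj {N : ℕ} (g : X → ProjSpace N) : Prop :=
  ∀ x : X, ∃ F : X → Fin (N + 1) → ℂ, IsHolomorphicLiftAt (E := E) g F x

variable (E X) in
/-- The complex manifold `X` is projective: it is compact, connected, Hausdorff, and has an
injective holomorphic immersion (hence a holomorphic embedding) in some projective space.
Immersivity is read on a lift `F`: the differential of `F` at `x` is injective modulo the
line spanned by `F x`. -/
structure IsProjectiveManifold : Prop where
  isManifold : IsManifold 𝓘(ℂ, E) ω X
  finiteDimensional : FiniteDimensional ℂ E
  t2 : T2Space X
  compact : CompactSpace X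
  connected : ConnectedSpace X
  exists_embedding : ∃ (N : ℕ) (g : X → ProjSpace N), Function.Injective g ∧
    ∀ x : X, ∃ F : X → Fin (N + 1) → ℂ, IsHolomorphicLiftAt (E := E) g F x ∧
      ∀ v : TangentSpace 𝓘(ℂ, E) x,
        (mfderiv 𝓘(ℂ, E) 𝓘(ℂ, Fin (N + 1) → ℂ) F x v : Fin (N + 1) → ℂ) ∈
          Submodule.span ℂ {F x} → v = 0

variable (E) in
/-- `Z` is a hypersurface of `X`: near every point of `X` it is the zero locus of a holomorphic
function which is not identically zero. -/
def IsHypersurface (Z : Set X) : Prop :=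
  ∀ x : X, ∃ f : X → ℂ, ContMDiffAt 𝓘(ℂ, E) 𝓘(ℂ, ℂ) ω f x ∧
    (¬ ∀ᶠ x' in 𝓝 x, f x' = 0) ∧ ∀ᶠ x' in 𝓝 x, (x' ∈ Z ↔ f x' = 0)

variable (E) in
/-- The differential at `y` of the map `U` to the projective line, in the affine coordinate of
the latter (for `U y ≠ ∞`), as a cotangent vector. -/
def dAff (U : X → ProjSpace 1) (y : X) : TangentSpace 𝓘(ℂ, E) y →L[ℂ] ℂ :=
  mfderiv 𝓘(ℂ, E) 𝓘(ℂ, ℂ) (fun x => affCoord (U x)) y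

variable (E) in
/-- The space of 1-forms on `Y ⊆ X`: families of cotangent vectors at the points of `Y`. -/
abbrev OneForm (Y : Set X) : Type _ := (y : Y) → (TangentSpace 𝓘(ℂ, E) (y : X) →L[ℂ] ℂ)

end Manifold

/-! ### Logarithmic 1-forms and iterated integrals on the projective line -/

/-- The finite part of a subset of the projective line. -/
def finPart (B : Set (ProjSpace 1)) : Set ℂ := {b | ofAffine b ∈ B}

/-- For `S ⊆ ℂ` finite, the space of logarithmic 1-forms on the projective line with poles in
`S ∪ {∞}`. The form `f(z) dz` is represented by `f`, extended by `0` to `S`. It has to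
be holomorphic off `S`, with at most a simple pole at each `b ∈ S`, and at most a simple pole at
`∞`, that is (as `dz = - dw / w ^ 2` for `w = 1 / z`) `f(z) = O(1 / z)` there. -/
def logForms (S : Set ℂ) : Submodule ℂ (ℂ → ℂ) where
  carrier := {f | DifferentiableOn ℂ f Sᶜ ∧
    (∀ b ∈ S, f b = 0) ∧
    (∀ b ∈ S, f =O[𝓝[≠] b] fun z => (z - b)⁻¹) ∧
    f =O[Filter.cocompact ℂ] fun z => z⁻¹}
  add_mem' := by
    rintro f g ⟨h1, h2, h3, h4⟩ ⟨k1, k2, k3, k4⟩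
    exact ⟨h1.add k1, fun b hb => by simp [h2 b hb, k2 b hb],
      fun b hb => (h3 b hb).add (k3 b hb), h4.add k4⟩
  zero_mem' := ⟨differentiableOn_const 0, fun _ _ => rfl,
    fun _ _ => Asymptotics.isBigO_zero _ _, Asymptotics.isBigO_zero _ _⟩
  smul_mem' := by
    rintro c f ⟨h1, h2, h3, h4⟩
    exact ⟨h1.const_smul c, fun b hb => by simp [h2 b hb],
      fun b hb => (h3 b hb).const_smul_left c, h4.const_smul_left c⟩

/-- The points `z` such that the straight path from `x` to `z` avoids `S`. -/
def starDomain (S : Set ℂ) (x : ℂ) : Set ℂ :=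
  {z | ∀ t : unitInterval, x + (t : ℂ) * (z - x) ∉ S}

/-- The straight path `t ↦ x + t (z - x)` from `x` to `z`, jointly continuous in `(z, t)`. -/
def ray (S : Set ℂ) (x : ℂ) : C(starDomain S x × unitInterval, starDomain S x) where
  toFun p := ⟨x + (p.2 : ℂ) * ((p.1 : ℂ) - x), fun t => by
    have h := p.1.2 (t * p.2)
    simpa [mul_assoc] using h⟩
  continuous_toFun := by fun_prop

/-- The restriction of a logarithmic form to a star domain. -/
def restrictForm (S : Set ℂ) (x : ℂ) : logForms S →ₗ[ℂ] C(starDomain S x, ℂ) where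
  toFun f := ⟨fun z => f.1 z, by
    have h : ContinuousOn f.1 (starDomain S x) :=
      f.2.1.continuousOn.mono (fun z hz => by simpa using hz 1)
    exact continuousOn_iff_continuous_domRestrict.1 h⟩
  map_add' _ _ := rfl
  map_smul' _ _ := rfl

/-- Integration over the unit interval, as a linear form on continuous functions. -/
def integralCLM : C(unitInterval, ℂ) →L[ℂ] ℂ :=
  LinearMap.mkContinuous
    { toFun := fun h => ∫ t, h t
      map_add' := fun h k => MeasureTheory.integral_add
        (h.continuous.integrable_of_hasCompactSupport (HasCompactSupport.of_compactSpace _))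
        (k.continuous.integrable_of_hasCompactSupport (HasCompactSupport.of_compactSpace _))
      map_smul' := fun c h => MeasureTheory.integral_smul c h } 1 (fun h => by
    simpa using MeasureTheory.norm_integral_le_of_norm_le_const
      (μ := (MeasureTheory.volume : MeasureTheory.Measure unitInterval))
      (Filter.Eventually.of_forall h.norm_coe_le_norm))

/-- Integration along straight paths: `h` is sent to `z ↦ ∫ h(ζ) dζ` over the path from `x`
to `z`, that is to `z ↦ (z - x) ∫ h(x + t (z - x)) dt` over `t ∈ [0, 1]`. -/
def primitive (S : Set ℂ) (x : ℂ) : C(starDomain S x, ℂ) →ₗ[ℂ] C(starDomain S x, ℂ) where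
  toFun h := ⟨fun z => ((z : ℂ) - x) * integralCLM ((h.comp (ray S x)).curry z), by fun_prop⟩
  map_add' h k := by
    ext1 z
    simp [mul_add]
  map_smul' c h := by
    ext1 z
    simp [mul_left_comm]

lemma primitive_apply (S : Set ℂ) (x : ℂ) (h : C(starDomain S x, ℂ)) (z : starDomain S x) :
    primitive S x h z = ((z : ℂ) - x) * ∫ t : unitInterval, h (ray S x (z, t)) := rfl

/-- The operator `g ↦ (z ↦ ∫ g ω)` (integral over the straight path from `x` to `z`)
attached to a logarithmic form `ω`. -/
def integrateAgainst (S : Set ℂ) (x : ℂ) :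
    logForms S →ₗ[ℂ] Module.End ℂ C(starDomain S x, ℂ) where
  toFun f := primitive S x ∘ₗ LinearMap.mulLeft ℂ (restrictForm S x f)
  map_add' f g := by ext1 h; simp [add_mul]
  map_smul' c f := by 
    ext1 h
    have : restrictForm S x (c • f) * h = c • (restrictForm S x f * h) := by
      rw [map_smul, smul_mul_assoc]
    simpa using congrArg (primitive S x) this |>.trans (map_smul _ _ _)

/-- The iterated integrals of weight `w` with base point `x`, as a linear map on tensors:
`ω₁ ⊗ ⋯ ⊗ ω_w` is sent to the function `z ↦ ∫ ω₁ ⊗ ⋯ ⊗ ω_w`, the iterated integral over the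
straight path from `x` to `z`, that is `∫ₓᶻ ω₁(t₁) ∫ₓ^{t₁} ω₂(t₂) ⋯ ∫ₓ^{t_{w-1}} ω_w(t_w)`. -/
def iteratedIntegral (S : Set ℂ) (x : ℂ) (w : ℕ) :
    (⨂[ℂ]^w (logForms S)) →ₗ[ℂ] C(starDomain S x, ℂ) where
  toFun τ := TensorAlgebra.lift ℂ (integrateAgainst S x) (TensorPower.toTensorAlgebra τ) 1
  map_add' _ _ := by simp
  map_smul' _ _ := by simp

open scoped Classical in
/-- The hyperlogarithm germ at `x` with symbol `τ`, as a function on `ℂ`: the iterated integral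
where this is defined (in particular near `x`, if `S` is finite and `x ∉ S`), and `0` elsewhere. -/
def hyperlog {S : Set ℂ} (x : ℂ) {w : ℕ} (τ : ⨂[ℂ]^w (logForms S)) (z : ℂ) : ℂ :=
  if h : z ∈ starDomain S x then iteratedIntegral S x w τ ⟨z, h⟩ else 0

/-! ### Antisymmetric symbols and pull-backs -/

/-- The antisymmetrization of `v₁ ⊗ ⋯ ⊗ v_s`. -/
def asym {M : Type*} [AddCommGroup M] [Module ℂ M] {s : ℕ} (v : Fin s → M) : ⨂[ℂ]^s M :=
  ((s.factorial : ℂ)⁻¹) • ∑ σ : Equiv.Perm (Fin s),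
    ((Equiv.Perm.sign σ : ℤ) : ℂ) • PiTensorProduct.tprod ℂ (fun k => v (σ k))

section PullBack

variable {E : Type*} [NormedAddCommGroup E] [NormedSpace ℂ E]
  {X : Type*} [TopologicalSpace X] [ChartedSpace E X]

/-- The branch locus of `U` relatively to `Y`: the complement of `U(Y)` in the projective line. -/
def branchLocus (Y : Set X) (U : X → ProjSpace 1) : Set (ProjSpace 1) := (U '' Y)ᶜ

/-- The logarithmic 1-forms on the projective line with poles in the branch locus of `U`
(which is assumed to contain `∞`). -/
abbrev LogFormsOf (Y : Set X) (U : X → ProjSpace 1) : Type :=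
  logForms (finPart (branchLocus Y U))

variable (E) in
/-- The pull-back of logarithmic 1-forms under `U`, as 1-forms on `Y`:
`U^*(f(z) dz) = f(U) dU`. -/
def pullback (Y : Set X) (U : X → ProjSpace 1) : LogFormsOf Y U →ₗ[ℂ] OneForm E Y where
  toFun f y := f.1 (affCoord (U y)) • dAff E U (y : X)
  map_add' f g := by ext1 y; exact add_smul (f.1 _) (g.1 _) (dAff E U (y : X))
  map_smul' c f := by ext1 y; exact mul_smul c (f.1 _) (dAff E U (y : X))

variable (E) in
/-- The space `H` of 1-forms on `Y`: the sum of the pull-backs under the `U i` of the spaces of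
logarithmic forms. -/
def totalForms {d : ℕ} (Y : Set X) (U : Fin d → X → ProjSpace 1) : Submodule ℂ (OneForm E Y) :=
  ⨆ i, LinearMap.range (pullback E Y (U i))

variable (E) in
/-- The pull-back under `U i` as a linear map to the space `H`. -/
def pullbackTo {d : ℕ} (Y : Set X) (U : Fin d → X → ProjSpace 1) (i : Fin d) :
    LogFormsOf Y (U i) →ₗ[ℂ] totalForms E Y U :=
  (pullback E Y (U i)).codRestrict (totalForms E Y U) (fun f =>
    Submodule.mem_iSup_of_mem (p := fun i => LinearMap.range (pullback E Y (U i))) i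
      (LinearMap.mem_range_self _ f))

variable (E) in
/-- The pull-back under `U i` on tensors of weight `w`. -/
def pullbackTensor {d : ℕ} (Y : Set X) (U : Fin d → X → ProjSpace 1) (i : Fin d) (w : ℕ) :
    (⨂[ℂ]^w (LogFormsOf Y (U i))) →ₗ[ℂ] ⨂[ℂ]^w (totalForms E Y U) :=
  PiTensorProduct.map (fun _ => pullbackTo E Y U i)

end PullBack

end HyperlogWeb

end

open HyperlogWeb

/-!
The equivalence is proved for arbitrary tensors of logarithmic forms (`tfae_symbol_hyperlog`).

*Words.* Choose a basis `h j` of the space `H` of 1-forms on `Y = Zᶜ`. A combination of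
pulled-back iterated integrals `I_{y_i}(w) ∘ U i`, along words `w` in the basis `ν i`, has a
symbol, which is a combination of words in the `h j`. The outermost integration corresponds to the
first letter, so `d (I_x(k w)) = I_x(w) ν k`, and the differential of the combination with symbol
`∑ j, h j ⊗ T j` is `∑ j, (combination with symbol T j) h j`. By induction on the weight, a
combination with zero symbol vanishes near every `y` (`WordSystem.eval_eventually_eq_zero`). This
is the direction from symbols to germs.

*From a germ to the symbol.* Let a combination of words of length at most `n + 1`, with base point
`y₀`, vanish near `y₀`. A change of base point (`wordIntegral_changeBase`) adds only shorter
words, so by the identity principle and the connectedness of `Y` there is at every `y ∈ Y` a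
vanishing combination `b y` with the same leading symbol. By induction on the weight, two such
combinations at `y` have the same symbol, hence the coefficients of the symbol of `b y` on words
of length `n` are single-valued functions of `y`. Changing the base point infinitesimally, the
differential of the coefficient of `J` is `∑ j, (coefficient of J j in the leading symbol) h j`.
An exact form in `H` is zero (see below), so the leading symbol is zero, and the induction goes on
(`WordSystem.IsRelation.symbol_eq_zero`).

*Exact forms in `H` are zero* (`eq_zero_of_hasMFDerivAt`). Let `d φ ∈ H` with `φ` a function on
`Y`. Along a disc through a point of `Z`, the derivative of `φ` has at most a simple pole; being
the derivative of a single-valued function, it has no residue, so `φ` extends holomorphically to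
the disc. By the maximum principle on such discs, `φ` is bounded near each point of `X` by its
values on a compact subset of `Y`. As `X` is compact, `‖φ‖` attains its maximum on `Y`; as `Y` is
connected, the maximum is attained everywhere, so `φ` is locally constant and `d φ = 0`. Only
discs are used, so the singularities of `Z` play no role.
-/

namespace HyperlogWeb

open Filter Set Metric

/-! ### Iterated integrals along words in one variable -/

lemma ball_subset_starDomain {S : Set ℂ} {x : ℂ} {r : ℝ} (hr : Disjoint (ball x r) S) :
    ball x r ⊆ starDomain S x := by
  intro z hz t
  refine Set.disjoint_left.1 hr ?_
  have ht : ‖(t : ℂ)‖ ≤ 1 := by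
    rw [Complex.norm_real, Real.norm_of_nonneg t.2.1]
    exact t.2.2
  have hz' : ‖z - x‖ < r := by rwa [mem_ball, dist_eq_norm] at hz
  rw [mem_ball, dist_eq_norm, add_sub_cancel_left, norm_mul]
  exact (mul_le_of_le_one_left (norm_nonneg _) ht).trans_lt hz'

open scoped Classical in
/-- On a disc around the base point which avoids `S`, the operator `primitive` yields the
primitive that vanishes at the base point. -/
lemma hasDerivAt_primitive {S : Set ℂ} {x : ℂ} {r : ℝ} (hr : Disjoint (ball x r) S)
    (h : C(starDomain S x, ℂ)) {g : ℂ → ℂ} (hg : DifferentiableOn ℂ g (ball x r))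
    (hgh : ∀ z (hz : z ∈ starDomain S x), h ⟨z, hz⟩ = g z) {z : ℂ} (hz : z ∈ ball x r) :
    HasDerivAt (fun z => if hz : z ∈ starDomain S x then primitive S x h ⟨z, hz⟩ else 0)
      (g z) z := by
  obtain ⟨G, hG⟩ := hg.isExactOn_ball
  have key : ∀ z ∈ ball x r,
      (if hz : z ∈ starDomain S x then primitive S x h ⟨z, hz⟩ else 0) = G z - G x := by
    intro z hz
    have hz' := ball_subset_starDomain hr hz
    have hseg : ∀ t ∈ Set.Icc (0 : ℝ) 1, x + t • (z - x) ∈ ball x r := by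
      intro t ht
      rw [mem_ball, dist_eq_norm, add_sub_cancel_left, norm_smul, Real.norm_of_nonneg ht.1]
      rw [mem_ball, dist_eq_norm] at hz
      exact (mul_le_of_le_one_left (norm_nonneg _) ht.2).trans_lt hz
    have := intervalIntegral.integral_unitInterval_deriv_eq_sub (f := G) (f' := g) (z₀ := x)
      (z₁ := z - x)
      (hg.continuousOn.comp (by fun_prop) hseg) (fun t ht => hG _ (hseg t ht))
    rw [dif_pos hz', primitive_apply]
    rw [add_sub_cancel, smul_eq_mul] at this
    rw [← this, intervalIntegral.integral_of_le zero_le_one,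
      ← MeasureTheory.integral_Icc_eq_integral_Ioc,
      ← MeasureTheory.integral_subtype_comap measurableSet_Icc]
    congr 1
    refine MeasureTheory.integral_congr_ae (Eventually.of_forall fun t => ?_)
    simp only [Complex.real_smul]
    exact hgh _ _
  refine ((hG z hz).sub_const (G x)).congr_of_eventuallyEq ?_
  filter_upwards [isOpen_ball.mem_nhds hz] with z hz using key z hz

section Words

variable {κ : Type*}

/-- The iterated integral of `ν k₁ ⊗ ⋯ ⊗ ν k_w` for a word `k₁ ⋯ k_w`, as a continuous function on
the star domain of the base point. -/
noncomputable def wordIntegralOn (S : Set ℂ) (ν : κ → logForms S) (x : ℂ) :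
    List κ → C(starDomain S x, ℂ)
  | [] => 1
  | k :: w => integrateAgainst S x (ν k) (wordIntegralOn S ν x w)

open scoped Classical in
/-- The iterated integral along a word, extended by `0` outside of the star domain. -/
noncomputable def wordIntegral {S : Set ℂ} (ν : κ → logForms S) (x : ℂ) (w : List κ) (z : ℂ) : ℂ :=
  if h : z ∈ starDomain S x then wordIntegralOn S ν x w ⟨z, h⟩ else 0

variable {S : Set ℂ} (ν : κ → logForms S) {x x' : ℂ} {r r' : ℝ}

lemma wordIntegral_nil (hr : Disjoint (ball x r) S) {z : ℂ} (hz : z ∈ ball x r) :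
    wordIntegral ν x [] z = 1 := by
  rw [wordIntegral, dif_pos (ball_subset_starDomain hr hz)]
  rfl

lemma wordIntegral_cons_self (k : κ) (w : List κ) : wordIntegral ν x (k :: w) x = 0 := by
  rw [wordIntegral]
  split_ifs with h
  · exact (primitive_apply S x _ _).trans (by simp)
  · rfl

lemma hasDerivAt_wordIntegral (hr : Disjoint (ball x r) S) (w : List κ) :
    ∀ k, ∀ z ∈ ball x r, HasDerivAt (wordIntegral ν x (k :: w))
      ((ν k).1 z * wordIntegral ν x w z) z := by
  have aux : ∀ w : List κ, DifferentiableOn ℂ (wordIntegral ν x w) (ball x r) → ∀ k,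
      ∀ z ∈ ball x r, HasDerivAt (wordIntegral ν x (k :: w))
        ((ν k).1 z * wordIntegral ν x w z) z := by
    intro w hw k z hz
    refine hasDerivAt_primitive hr _ (g := fun z => (ν k).1 z * wordIntegral ν x w z)
      (((ν k).2.1.mono fun z hz => Set.disjoint_left.1 hr hz).mul hw) (fun z hz => ?_) hz
    simp only [wordIntegral, dif_pos hz]
    rfl
  induction w with
  | nil =>
    exact aux [] ((differentiableOn_const 1).congr fun z hz => wordIntegral_nil ν hr hz)
  | cons k w ih =>
    exact aux _ fun z hz => (ih k z hz).differentiableAt.differentiableWithinAt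

lemma differentiableOn_wordIntegral (hr : Disjoint (ball x r) S) (w : List κ) :
    DifferentiableOn ℂ (wordIntegral ν x w) (ball x r) := by
  cases w with
  | nil => exact (differentiableOn_const 1).congr fun z hz => wordIntegral_nil ν hr hz
  | cons k w => exact fun z hz =>
      (hasDerivAt_wordIntegral ν hr w k z hz).differentiableAt.differentiableWithinAt

/-- Change of base point (path composition): an iterated integral based at `x` is a combination of
iterated integrals based at `x'` of the initial subwords. -/
lemma wordIntegral_changeBase (hr : Disjoint (ball x r) S) (hr' : Disjoint (ball x' r') S)
    (hx' : x' ∈ ball x r) (w : List κ) :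
    ∀ z ∈ ball x r ∩ ball x' r', wordIntegral ν x w z =
      ∑ n ∈ Finset.range (w.length + 1),
        wordIntegral ν x (w.drop n) x' * wordIntegral ν x' (w.take n) z := by
  induction w with
  | nil =>
    intro z hz
    simp [wordIntegral_nil ν hr hz.1, wordIntegral_nil ν hr' hz.2, wordIntegral_nil ν hr hx']
  | cons k w ih =>
    have hr'0 : ∀ z ∈ ball x r ∩ ball x' r', x' ∈ ball x r ∩ ball x' r' := fun z hz =>
      ⟨hx', mem_ball_self (dist_nonneg.trans_lt hz.2)⟩
    intro z hz
    have hd : ∀ z ∈ ball x r ∩ ball x' r', HasDerivAt (fun z =>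
        ∑ n ∈ Finset.range ((k :: w).length + 1),
          wordIntegral ν x ((k :: w).drop n) x' * wordIntegral ν x' ((k :: w).take n) z)
        ((ν k).1 z * wordIntegral ν x w z) z := by
      intro z hz
      have h0 : HasDerivAt
          (fun z => wordIntegral ν x (k :: w) x' * wordIntegral ν x' [] z) 0 z := by
        refine (hasDerivAt_const z (wordIntegral ν x (k :: w) x')).congr_of_eventuallyEq ?_
        filter_upwards [isOpen_ball.mem_nhds hz.2] with z hz
        rw [wordIntegral_nil ν hr' hz, mul_one]
      have h1 : HasDerivAt (fun z => ∑ n ∈ Finset.range (w.length + 1),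
          wordIntegral ν x (w.drop n) x' * wordIntegral ν x' (k :: w.take n) z)
          (∑ n ∈ Finset.range (w.length + 1), wordIntegral ν x (w.drop n) x' *
            ((ν k).1 z * wordIntegral ν x' (w.take n) z)) z :=
        HasDerivAt.fun_sum fun n _ =>
          (hasDerivAt_wordIntegral ν hr' (w.take n) k z hz.2).const_mul _
      simp only [List.length_cons, Finset.sum_range_succ' _ (w.length + 1)]
      refine (h1.fun_add h0).congr_deriv ?_
      rw [ih z hz, Finset.mul_sum, add_zero]
      exact Finset.sum_congr rfl fun n _ => mul_left_comm _ _ _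
    have hU : IsOpen (ball x r ∩ ball x' r') := isOpen_ball.inter isOpen_ball
    refine hU.eqOn_of_deriv_eq ((convex_ball x r).inter (convex_ball x' r')).isPreconnected
      (fun z hz =>
        (hasDerivAt_wordIntegral ν hr w k z hz.1).differentiableAt.differentiableWithinAt)
      (fun z hz => (hd z hz).differentiableAt.differentiableWithinAt)
      (fun z hz => ?_) (hr'0 z hz) ?_ hz
    · rw [(hd z hz).deriv, (hasDerivAt_wordIntegral ν hr w k z hz.1).deriv]
    · rw [List.length_cons, Finset.sum_range_succ']
      simp [wordIntegral_cons_self, wordIntegral_nil ν hr' (hr'0 z hz).2]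

lemma lift_integrateAgainst_list_prod (w : List κ) :
    TensorAlgebra.lift ℂ (integrateAgainst S x) ((w.map fun k => TensorAlgebra.ι ℂ (ν k)).prod) 1 =
      wordIntegralOn S ν x w := by
  induction w with
  | nil => simp [wordIntegralOn]
  | cons k w ih =>
    rw [List.map_cons, List.prod_cons, map_mul, TensorAlgebra.lift_ι_apply, Module.End.mul_apply,
      ih]
    rfl

lemma hyperlog_tprod {n : ℕ} (w : Fin n → κ) (z : ℂ) :
    hyperlog x (PiTensorProduct.tprod ℂ fun t => ν (w t)) z =
      wordIntegral ν x (List.ofFn w) z := by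
  have : ∀ h : z ∈ starDomain S x,
      iteratedIntegral S x n (PiTensorProduct.tprod ℂ fun t => ν (w t)) ⟨z, h⟩ =
        wordIntegralOn S ν x (List.ofFn w) ⟨z, h⟩ := by
    intro h
    rw [← lift_integrateAgainst_list_prod]
    simp [iteratedIntegral, TensorPower.toTensorAlgebra_tprod, TensorAlgebra.tprod_apply,
      List.map_ofFn, Function.comp_def]
  simp only [hyperlog, wordIntegral]
  split_ifs with h
  · exact this h
  · rfl

end Words

lemma hyperlog_sum_smul {S : Set ℂ} {x : ℂ} {n : ℕ} {α : Type*} (s : Finset α) (c : α → ℂ)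
    (τ : α → ⨂[ℂ]^n (logForms S)) (z : ℂ) :
    hyperlog x (∑ a ∈ s, c a • τ a) z = ∑ a ∈ s, c a * hyperlog x (τ a) z := by
  simp only [hyperlog]
  split_ifs with h
  · simp [map_sum, ContinuousMap.sum_apply]
  · simp

end HyperlogWeb

namespace HyperlogWeb

open Filter Set Metric Asymptotics

/-! ### Connectedness of complements of analytic hypersurfaces -/

/-- A dense subset of a preconnected set whose traces on small neighbourhoods are preconnected
is preconnected. -/
lemma isPreconnected_of_forall_nhds {M : Type*} [TopologicalSpace M] {C Y : Set M}
    (hC : IsPreconnected C) (hYC : Y ⊆ C) (hdense : C ⊆ closure Y)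
    (hloc : ∀ x ∈ C, ∃ N ∈ 𝓝 x, IsPreconnected (N ∩ Y)) : IsPreconnected Y := by
  rw [isPreconnected_iff_subset_of_disjoint] at hC ⊢
  intro u v hu hv huv hdisj
  -- a separation of `Y` extends to one of `C`: near each point of `C`, `Y` lies on one side
  have hcover : C ⊆ interior {x | x ∈ Y → x ∈ u} ∪ interior {x | x ∈ Y → x ∈ v} := by
    intro x hx
    obtain ⟨N, hN, hNY⟩ := hloc x hx
    rw [isPreconnected_iff_subset_of_disjoint] at hNY
    rcases hNY u v hu hv (inter_subset_right.trans huv)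
      (subset_empty_iff.1 (hdisj ▸ inter_subset_inter_left _ inter_subset_right)) with h | h
    · exact Or.inl (mem_interior_iff_mem_nhds.2 (mem_of_superset hN fun z hz hzY => h ⟨hz, hzY⟩))
    · exact Or.inr (mem_interior_iff_mem_nhds.2 (mem_of_superset hN fun z hz hzY => h ⟨hz, hzY⟩))
  have hempty : C ∩ (interior {x | x ∈ Y → x ∈ u} ∩ interior {x | x ∈ Y → x ∈ v}) = ∅ := by
    rw [eq_empty_iff_forall_notMem]
    rintro x ⟨hx, hxu, hxv⟩
    obtain ⟨y, ⟨hyu, hyv⟩, hyY⟩ := mem_closure_iff.1 (hdense hx) _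
      (isOpen_interior.inter isOpen_interior) ⟨hxu, hxv⟩
    exact (hdisj ▸ notMem_empty y : y ∉ Y ∩ (u ∩ v))
      ⟨hyY, interior_subset hyu hyY, interior_subset hyv hyY⟩
  rcases hC _ _ isOpen_interior isOpen_interior hcover hempty with h | h
  · exact Or.inl fun y hy => interior_subset (h (hYC hy)) hy
  · exact Or.inr fun y hy => interior_subset (h (hYC hy)) hy

lemma isPreconnected_puncturedBall (c : ℂ) (r : ℝ) : IsPreconnected (ball c r \ {c}) := by
  rcases le_or_gt r 0 with hr | hr
  · simp [ball_eq_empty.2 hr, isPreconnected_empty]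
  -- a punctured disc is the image of a half-plane under `z ↦ c + exp z`
  have : ball c r \ {c} = (fun z => c + Complex.exp z) '' {z | z.re < Real.log r} := by
    ext w
    simp only [Set.mem_sdiff, mem_ball, dist_eq_norm, mem_singleton_iff, mem_image, mem_ofPred_eq]
    constructor
    · rintro ⟨hw, hwc⟩
      have h0 : w - c ≠ 0 := sub_ne_zero.2 hwc
      refine ⟨Complex.log (w - c), ?_, by rw [Complex.exp_log h0]; ring⟩
      rw [Complex.log_re]
      exact Real.log_lt_log (norm_pos_iff.2 h0) hw
    · rintro ⟨z, hz, rfl⟩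
      refine ⟨?_, by simp [Complex.exp_ne_zero]⟩
      rw [add_sub_cancel_left, Complex.norm_exp]
      exact (Real.lt_log_iff_exp_lt hr).1 hz
  rw [this]
  exact (convex_halfSpace_re_lt _).isPreconnected.image _ (by fun_prop)

lemma isPreconnected_ne_zero_of_analyticOnNhd_complex {D : Set ℂ} (hD : IsOpen D)
    (hconv : Convex ℝ D) {g : ℂ → ℂ} (hg : AnalyticOnNhd ℂ g D) :
    IsPreconnected {t ∈ D | g t ≠ 0} := by
  by_cases hex : EqOn g 0 D
  · convert! isPreconnected_empty using 1
    rw [eq_empty_iff_forall_notMem]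
    exact fun t ht => ht.2 (hex ht.1)
  have hne : ∀ t ∈ D, ∀ᶠ z in 𝓝[≠] t, g z ≠ 0 := by
    intro t ht
    by_contra h
    exact hex (hg.eqOn_zero_of_preconnected_of_frequently_eq_zero hconv.isPreconnected ht
      ((not_eventually.1 h).mono fun z hz => not_not.1 hz))
  refine isPreconnected_of_forall_nhds hconv.isPreconnected (fun t ht => ht.1) ?_ ?_
  · intro t ht
    have : ∃ᶠ z in 𝓝[≠] t, z ∈ {t ∈ D | g t ≠ 0} := by
      apply Eventually.frequently
      filter_upwards [hne t ht, mem_nhdsWithin_of_mem_nhds (hD.mem_nhds ht)] with z h1 h2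
        using ⟨h2, h1⟩
    exact mem_closure_iff_frequently.2 (this.filter_mono nhdsWithin_le_nhds)
  · intro t ht
    obtain ⟨r, hr, hball⟩ := Metric.eventually_nhds_iff_ball.1
      ((eventually_nhdsWithin_iff.1 (hne t ht)).and (hD.mem_nhds ht))
    refine ⟨ball t r, ball_mem_nhds t hr, ?_⟩
    by_cases h0 : g t = 0
    · convert! isPreconnected_puncturedBall t r using 1
      ext z
      constructor
      · rintro ⟨h1, h2, h3⟩
        exact ⟨h1, fun h => h3 (h ▸ h0)⟩
      · rintro ⟨h1, h2⟩
        exact ⟨h1, (hball z h1).2, (hball z h1).1 h2⟩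
    · convert! (convex_ball t r).isPreconnected using 1
      ext z
      refine ⟨fun h => h.1, fun h => ⟨h, (hball z h).2, ?_⟩⟩
      by_cases hz : z = t
      · exact hz ▸ h0
      · exact (hball z h).1 hz

/-- The complement of the zero set of an analytic function in a convex open set is preconnected:
two of its points are joined inside the complex line through them. -/
lemma isPreconnected_ne_zero_of_analyticOnNhd {E : Type*} [NormedAddCommGroup E] [NormedSpace ℂ E]
    {B : Set E} (hB : IsOpen B) (hconv : Convex ℝ B) {f : E → ℂ} (hf : AnalyticOnNhd ℂ f B) :
    IsPreconnected {p ∈ B | f p ≠ 0} := by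
  refine isPreconnected_of_forall_pair ?_
  intro p hp q hq
  let γ : ℂ → E := fun t => p + t • (q - p)
  have hγ : Continuous γ := by fun_prop
  have hγa : AnalyticOnNhd ℂ γ univ := fun t _ => by fun_prop
  have hDc : Convex ℝ (γ ⁻¹' B) := by
    intro a ha b hb s t hs ht hst
    have : γ (s • a + t • b) = s • γ a + t • γ b := by
      have hp' : p = s • p + t • p := by rw [← add_smul, hst, one_smul]
      simp only [γ, add_smul, smul_add, smul_assoc]
      nth_rw 1 [hp']
      abel
    rw [mem_preimage, this]
    exact hconv ha hb hs ht hst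
  have := isPreconnected_ne_zero_of_analyticOnNhd_complex (hB.preimage hγ) hDc
    (g := f ∘ γ) (hf.comp (hγa.mono (subset_univ _)) (fun t ht => ht))
  refine ⟨γ '' {t ∈ γ ⁻¹' B | (f ∘ γ) t ≠ 0}, ?_, ⟨0, ?_, ?_⟩, ⟨1, ?_, ?_⟩,
    this.image _ hγ.continuousOn⟩
  · rintro _ ⟨t, ht, rfl⟩
    exact ht
  all_goals simp [γ, hp.1, hp.2, hq.1, hq.2]

/-! ### Logarithmic singularities in one variable -/

lemma logDeriv_isBigO {g : ℂ → ℂ} {c : ℂ} (hg : MeromorphicAt g c)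
    (hne : ∀ᶠ t in 𝓝[≠] c, g t ≠ 0) :
    logDeriv g =O[𝓝[≠] c] fun t => (t - c)⁻¹ := by
  have hlog : MeromorphicAt (logDeriv g) c := hg.deriv.div hg
  have hid : MeromorphicAt (fun t => t - c) c := by fun_prop
  have hord : 0 ≤ meromorphicOrderAt ((fun t => t - c) * logDeriv g) c := by
    have h1 : meromorphicOrderAt (fun t => t - c) c = 1 := by
      rw [show (1 : WithTop ℤ) = ((1 : ℤ) : WithTop ℤ) from rfl, meromorphicOrderAt_eq_int_iff hid]
      exact ⟨1, analyticAt_const, one_ne_zero, by simp⟩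
    rw [meromorphicOrderAt_mul hid hlog, h1]
    by_cases h0 : meromorphicOrderAt g c = 0
    · exact add_nonneg zero_le_one (meromorphicOrderAt_logDeriv_nonneg hg h0)
    · rw [meromorphicOrderAt_logDeriv_eq_neg_one hg h0
        ((meromorphicOrderAt_ne_top_iff_eventually_ne_zero hg).2 hne)]
      rfl
  obtain ⟨a, ha⟩ := tendsto_nhds_of_meromorphicOrderAt_nonneg (hid.mul hlog) hord
  have := (ha.isBigO_one ℂ).mul (isBigO_refl (fun t => (t - c)⁻¹) (𝓝[≠] c))
  refine this.congr' ?_ (Eventually.of_forall fun t => one_mul _)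
  filter_upwards [self_mem_nhdsWithin] with t ht
  have : t - c ≠ 0 := sub_ne_zero.2 ht
  simp only [Pi.mul_apply]
  field_simp

/-- The pull-back of a logarithmic form under a meromorphic function has at most simple poles. -/
lemma logForms_comp_isBigO {S : Set ℂ} (hS : IsClosed S) (f : logForms S) {u : ℂ → ℂ} {c : ℂ}
    (hu : MeromorphicAt u c) :
    (fun t => f.1 (u t) * deriv u t) =O[𝓝[≠] c] fun t => (t - c)⁻¹ := by
  obtain ⟨hdiff, hzero, hpole, hinf⟩ := f.2
  rcases lt_or_ge (meromorphicOrderAt u c) 0 with hord | hord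
  · have htend : Tendsto u (𝓝[≠] c) (cocompact ℂ) := by
      rw [← Metric.cobounded_eq_cocompact]
      exact tendsto_cobounded_of_meromorphicOrderAt_neg hord
    have hne : ∀ᶠ t in 𝓝[≠] c, u t ≠ 0 :=
      (meromorphicOrderAt_ne_top_iff_eventually_ne_zero hu).1 (fun h => by simp [h] at hord)
    refine ((hinf.comp_tendsto htend).mul (isBigO_refl (deriv u) _)).trans ?_
    refine (logDeriv_isBigO hu hne).congr_left fun t => ?_
    simp [logDeriv_apply, div_eq_inv_mul]
  · obtain ⟨b, hb⟩ := tendsto_nhds_of_meromorphicOrderAt_nonneg hu hord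
    have hub : MeromorphicAt (fun t => u t - b) c := hu.sub (MeromorphicAt.const b c)
    rcases hub.eventually_eq_zero_or_eventually_ne_zero with h | h
    · -- `u` is constant
      refine IsBigO.congr' (isBigO_zero _ _) ?_ EventuallyEq.rfl
      have h' : u =ᶠ[𝓝[≠] c] fun _ => b := h.mono fun t ht => sub_eq_zero.1 ht
      filter_upwards [h'.nhdsNE_deriv] with t ht
      simp [ht]
    · have htend : Tendsto u (𝓝[≠] c) (𝓝[≠] b) :=
        tendsto_nhdsWithin_iff.2 ⟨hb, h.mono fun t ht => sub_ne_zero.1 ht⟩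
      have hf : f.1 =O[𝓝[≠] b] fun z => (z - b)⁻¹ := by
        by_cases hbS : b ∈ S
        · exact hpole b hbS
        · have h1 : f.1 =O[𝓝[≠] b] (1 : ℂ → ℂ) :=
            ((hdiff.differentiableAt
              (hS.isOpen_compl.mem_nhds hbS)).continuousAt.tendsto.isBigO_one ℂ).mono
              nhdsWithin_le_nhds
          refine h1.trans ?_
          have h2 : (fun z => z - b) =O[𝓝[≠] b] (1 : ℂ → ℂ) :=
            ((show ContinuousAt (fun z => z - b) b by fun_prop).tendsto.isBigO_one ℂ).mono
              nhdsWithin_le_nhds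
          refine (h2.mul (isBigO_refl (fun z => (z - b)⁻¹) _)).congr' ?_
            (Eventually.of_forall fun t => one_mul _)
          filter_upwards [self_mem_nhdsWithin] with z hz
          exact mul_inv_cancel₀ (sub_ne_zero.2 hz)
      refine ((hf.comp_tendsto htend).mul (isBigO_refl (deriv u) _)).trans ?_
      refine (logDeriv_isBigO hub h).congr_left fun t => ?_
      simp [logDeriv_apply, div_eq_inv_mul]

/-- A single-valued primitive of a function with at most a simple pole has a removable
singularity: the residue is zero, as it is an integral of a derivative over a circle. -/
lemma exists_analyticAt_of_deriv_isBigO {F : ℂ → ℂ} {c : ℂ}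
    (hF : ∀ᶠ t in 𝓝[≠] c, DifferentiableAt ℂ F t)
    (hO : deriv F =O[𝓝[≠] c] fun t => (t - c)⁻¹) :
    ∃ P : ℂ → ℂ, AnalyticAt ℂ P c ∧ F =ᶠ[𝓝[≠] c] P := by
  obtain ⟨C, hC⟩ := hO.bound
  obtain ⟨r, hr, hball⟩ := Metric.eventually_nhds_iff_ball.1
    ((eventually_nhdsWithin_iff.1 hF).and (eventually_nhdsWithin_iff.1 hC))
  have hopen : IsOpen (ball c r \ {c}) := isOpen_ball.sdiff isClosed_singleton
  have hFd : DifferentiableOn ℂ F (ball c r \ {c}) := fun t ht =>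
    ((hball t ht.1).1 ht.2).differentiableWithinAt
  let K : ℂ → ℂ := fun t => (t - c) * deriv F t
  have hKd : DifferentiableOn ℂ K (ball c r \ {c}) :=
    (DifferentiableOn.sub_const (by fun_prop) c).mul (hFd.deriv hopen)
  have hKb : BddAbove (norm ∘ K '' (ball c r \ {c})) := by
    refine ⟨C, ?_⟩
    rintro _ ⟨t, ht, rfl⟩
    have h1 := (hball t ht.1).2 ht.2
    have h2 : 0 < ‖t - c‖ := norm_pos_iff.2 (sub_ne_zero.2 ht.2)
    simp only [Function.comp_apply, K, norm_mul]
    rw [norm_inv] at h1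
    calc ‖t - c‖ * ‖deriv F t‖ ≤ ‖t - c‖ * (C * ‖t - c‖⁻¹) := by gcongr
      _ = C := by field_simp
  -- the residue of `deriv F` at `c`
  let a := limUnder (𝓝[≠] c) K
  let K' := Function.update K c a
  have hK' : DifferentiableOn ℂ K' (ball c r) :=
    Complex.differentiableOn_update_limUnder_of_bddAbove (ball_mem_nhds c hr) hKd hKb
  obtain ⟨P, hP⟩ := DifferentiableOn.isExactOn_ball
    ((Complex.differentiableOn_dslope (ball_mem_nhds c hr)).2 hK')
  have hderiv : ∀ t ∈ ball c r \ {c},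
      HasDerivAt (fun t => F t - P t) (a * (t - c)⁻¹) t := by
    intro t ht
    refine (((hball t ht.1).1 ht.2).hasDerivAt.sub (hP t ht.1)).congr_deriv ?_
    have h2 : t - c ≠ 0 := sub_ne_zero.2 ht.2
    rw [dslope_of_ne _ ht.2, slope_def_field]
    simp only [K', K, Function.update_of_ne ht.2, Function.update_self]
    field_simp
    ring
  have ha : a = 0 := by
    have h1 : (∮ t in C(c, r / 2), a * (t - c)⁻¹) = 0 := by
      refine circleIntegral.integral_eq_zero_of_hasDerivWithinAt
        (f := fun t => F t - P t) (by positivity) (fun t ht => ?_)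
      refine (hderiv t ⟨sphere_subset_ball (half_lt_self hr) ht, ?_⟩).hasDerivWithinAt
      exact fun h => ne_of_mem_sphere ht (half_pos hr).ne' h
    rw [circleIntegral.integral_const_mul, circleIntegral.integral_sub_center_inv _
      (half_pos hr).ne'] at h1
    exact (mul_eq_zero.1 h1).resolve_right Complex.two_pi_I_ne_zero
  obtain ⟨b, hb⟩ := hopen.exists_is_const_of_deriv_eq_zero (isPreconnected_puncturedBall c r)
    (fun t ht => (hderiv t ht).differentiableAt.differentiableWithinAt)
    (fun t ht => by rw [(hderiv t ht).deriv, ha, zero_mul]; rfl)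
  refine ⟨fun t => P t + b, ?_, ?_⟩
  · refine AnalyticAt.add ?_ analyticAt_const
    exact (DifferentiableOn.analyticAt (s := ball c r)
      (fun t ht => (hP t ht).differentiableAt.differentiableWithinAt) (ball_mem_nhds c hr))
  · filter_upwards [mem_nhdsWithin_of_mem_nhds (ball_mem_nhds c hr), self_mem_nhdsWithin]
      with t h1 h2
    rw [← hb t ⟨h1, h2⟩]
    ring

/-- Maximum principle on a disc for a function with isolated singularities at which its derivative
has at most simple poles. -/
lemma norm_center_le_of_deriv_isBigO {F : ℂ → ℂ} {r : ℝ} (hr : 0 < r) {C : ℝ}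
    (hF : ∀ c ∈ closedBall (0 : ℂ) r, ∀ᶠ t in 𝓝[≠] c, DifferentiableAt ℂ F t)
    (hO : ∀ c ∈ closedBall (0 : ℂ) r, deriv F =O[𝓝[≠] c] fun t => (t - c)⁻¹)
    (h0 : ContinuousAt F 0) (hcont : ∀ t ∈ sphere (0 : ℂ) r, ContinuousAt F t)
    (hC : ∀ t ∈ sphere (0 : ℂ) r, ‖F t‖ ≤ C) : ‖F 0‖ ≤ C := by
  -- the holomorphic extension of `F` through its singularities
  let G : ℂ → ℂ := fun c => limUnder (𝓝[≠] c) F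
  have hGF : ∀ c, ContinuousAt F c → G c = F c := fun c hc =>
    (hc.tendsto.mono_left nhdsWithin_le_nhds).limUnder_eq
  have hG : ∀ c ∈ closedBall (0 : ℂ) r, AnalyticAt ℂ G c := by
    intro c hc
    obtain ⟨P, hP, hFP⟩ := exists_analyticAt_of_deriv_isBigO (hF c hc) (hO c hc)
    refine hP.congr ?_
    have h1 : P c = G c := (((hP.continuousAt.tendsto.mono_left nhdsWithin_le_nhds).congr'
      hFP.symm).limUnder_eq).symm
    have h2 : ∀ᶠ t in 𝓝[≠] c, P t = G t := by
      filter_upwards [hFP, hF c hc] with t h3 h4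
      rw [hGF t h4.continuousAt, h3]
    filter_upwards [eventually_nhdsWithin_iff.1 h2] with t ht
    by_cases htc : t = c
    · rw [htc, h1]
    · exact ht htc
  have hd : DiffContOnCl ℂ G (ball 0 r) := by
    refine DifferentiableOn.diffContOnCl fun t ht => ?_
    rw [closure_ball _ hr.ne'] at ht
    exact (hG t ht).differentiableAt.differentiableWithinAt
  have := Complex.norm_le_of_forall_mem_frontier_norm_le isBounded_ball hd (C := C)
    (fun t ht => ?_) (subset_closure (mem_ball_self hr))
  · rwa [hGF 0 h0] at this
  · rw [frontier_ball _ hr.ne'] at ht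
    rw [hGF t (hcont t ht)]
    exact hC t ht

end HyperlogWeb

namespace HyperlogWeb

open Filter Set Metric Asymptotics

/-! ### Holomorphic functions in charts and along discs -/

lemma eventually_of_eventually_comp_chartAt_symm {E : Type*} [TopologicalSpace E] {X : Type*}
    [TopologicalSpace X] [ChartedSpace E X] (x : X) {p : X → Prop}
    (h : ∀ᶠ z in 𝓝 (chartAt E x x), p ((chartAt E x).symm z)) : ∀ᶠ x' in 𝓝 x, p x' := by
  filter_upwards [(chartAt E x).continuousAt (mem_chart_source E x) |>.eventually h,
    (chartAt E x).open_source.mem_nhds (mem_chart_source E x)] with x' h1 h2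
  rwa [(chartAt E x).left_inv h2] at h1

lemma eventually_comp_chartAt_symm {E : Type*} [TopologicalSpace E] {X : Type*}
    [TopologicalSpace X] [ChartedSpace E X] (x : X) {p : X → Prop} (h : ∀ᶠ x' in 𝓝 x, p x') :
    ∀ᶠ z in 𝓝 (chartAt E x x), p ((chartAt E x).symm z) := by
  have h1 := (chartAt E x).continuousAt_symm (mem_chart_target E x)
  rw [ContinuousAt, (chartAt E x).left_inv (mem_chart_source E x)] at h1
  exact h1.eventually h

section Charts

variable {E : Type*} [NormedAddCommGroup E] [NormedSpace ℂ E]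
  {X : Type*} [TopologicalSpace X] [ChartedSpace E X]

lemma contMDiffAt_chartAt_symm [IsManifold 𝓘(ℂ, E) ω X] (x : X) {p : E}
    (hp : p ∈ (chartAt E x).target) :
    ContMDiffAt 𝓘(ℂ, E) 𝓘(ℂ, E) ω (chartAt E x).symm p :=
  contMDiffOn_chart_symm.contMDiffAt ((chartAt E x).open_target.mem_nhds hp)

lemma analyticAt_comp_chartAt_symm [IsManifold 𝓘(ℂ, E) ω X] {F : Type*} [NormedAddCommGroup F]
    [NormedSpace ℂ F] [CompleteSpace F] (x : X) {p : E} (hp : p ∈ (chartAt E x).target)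
    {f : X → F} (hf : ContMDiffAt 𝓘(ℂ, E) 𝓘(ℂ, F) ω f ((chartAt E x).symm p)) :
    AnalyticAt ℂ (f ∘ (chartAt E x).symm) p :=
  (hf.comp p (contMDiffAt_chartAt_symm x hp)).contDiffAt.analyticAt

/-- A function whose differential vanishes near a point is constant near this point. -/
lemma eventually_eq_of_hasMFDerivAt_zero [IsManifold 𝓘(ℂ, E) ω X] {f : X → ℂ} {x : X}
    (h : ∀ᶠ x' in 𝓝 x, HasMFDerivAt 𝓘(ℂ, E) 𝓘(ℂ, ℂ) f x'
      (0 : TangentSpace 𝓘(ℂ, E) x' →L[ℂ] ℂ)) :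
    ∀ᶠ x' in 𝓝 x, f x' = f x := by
  refine eventually_of_eventually_comp_chartAt_symm (E := E) x ?_
  obtain ⟨r, hr, hball⟩ := Metric.eventually_nhds_iff_ball.1
    ((eventually_comp_chartAt_symm (E := E) x h).and
      ((chartAt E x).open_target.mem_nhds (mem_chart_target E x)))
  have hd : ∀ p ∈ ball (chartAt E x x) r,
      HasFDerivAt (f ∘ (chartAt E x).symm) (0 : E →L[ℂ] ℂ) p := by
    intro p hp
    obtain ⟨h1, h2⟩ := hball p hp
    have h3 := ((contMDiffAt_chartAt_symm x h2).mdifferentiableAt (by simp)).hasMFDerivAt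
    exact (h1.comp p h3).hasFDerivAt.congr_fderiv (by ext; rfl)
  filter_upwards [ball_mem_nhds (chartAt E x x) hr] with p hp
  have := (convex_ball (chartAt E x x) r).isPreconnected
  have := isOpen_ball.is_const_of_fderiv_eq_zero (𝕜 := ℂ) this
    (fun p hp => (hd p hp).differentiableAt.differentiableWithinAt)
    (fun p hp => (hd p hp).fderiv) hp (mem_ball_self hr)
  simpa using this

/-- Maximum modulus principle on a manifold, local form. -/
lemma eventually_eq_of_eventually_norm_le [IsManifold 𝓘(ℂ, E) ω X] {f : X → ℂ} {x : X}
    (h : ∀ᶠ x' in 𝓝 x, MDifferentiableAt 𝓘(ℂ, E) 𝓘(ℂ, ℂ) f x')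
    (hmax : ∀ᶠ x' in 𝓝 x, ‖f x'‖ ≤ ‖f x‖) : ∀ᶠ x' in 𝓝 x, f x' = f x := by
  refine eventually_of_eventually_comp_chartAt_symm (E := E) x ?_
  have hx : (chartAt E x).symm (chartAt E x x) = x :=
    (chartAt E x).left_inv (mem_chart_source E x)
  have := Complex.eventually_eq_of_isLocalMax_norm (f := f ∘ (chartAt E x).symm)
    (c := chartAt E x x) ?_ ?_
  · filter_upwards [this] with z hz
    simpa using hz
  · filter_upwards [eventually_comp_chartAt_symm (E := E) x h,
      (chartAt E x).open_target.mem_nhds (mem_chart_target E x)] with p h1 h2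
    exact (h1.comp p ((contMDiffAt_chartAt_symm x h2).mdifferentiableAt
      (by simp))).differentiableAt
  · filter_upwards [eventually_comp_chartAt_symm (E := E) x hmax] with p hp
    simpa using hp

end Charts

lemma iff_of_isPreconnected {M : Type*} [TopologicalSpace M] {Y : Set M} (hY : IsPreconnected Y)
    {P : M → Prop} (h : ∀ y ∈ Y, ∀ᶠ y' in 𝓝 y, P y' ↔ P y) {y y' : M}
    (hy : y ∈ Y) (hy' : y' ∈ Y) : P y ↔ P y' :=
  hY.induction₂ (fun y y' => P y ↔ P y')
    (fun y hy => ((h y hy).mono fun _ => Iff.symm).filter_mono nhdsWithin_le_nhds)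
    (fun _ _ _ _ _ _ => Iff.trans) (fun _ _ _ _ => Iff.symm) hy hy'

/-! ### Complements of hypersurfaces -/

section Hypersurface

variable {E : Type*} [NormedAddCommGroup E] [NormedSpace ℂ E]
  {X : Type*} [TopologicalSpace X] [ChartedSpace E X] {Z : Set X}

lemma IsHypersurface.isOpen_compl (hZ : IsHypersurface E Z) : IsOpen Zᶜ := by
  rw [isOpen_iff_mem_nhds]
  intro y hy
  obtain ⟨f, hf, -, hfZ⟩ := hZ y
  have h0 : f y ≠ 0 := fun h => hy (hfZ.self_of_nhds.2 h)
  filter_upwards [hfZ, hf.continuousAt.eventually_ne h0] with x h1 h2 using fun h => h2 (h1.1 h)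

lemma IsHypersurface.dense_compl (hZ : IsHypersurface E Z) : Dense Zᶜ := by
  intro x
  obtain ⟨f, -, hne, hfZ⟩ := hZ x
  rw [mem_closure_iff_frequently]
  exact ((not_eventually.1 hne).and_eventually hfZ).mono fun z hz h => hz.1 (hz.2.1 h)

/-- A local equation of a hypersurface, read on a ball in a chart. -/
lemma IsHypersurface.exists_equation [IsManifold 𝓘(ℂ, E) ω X] (hZ : IsHypersurface E Z) (x : X) :
    ∃ (f : E → ℂ) (ρ : ℝ), 0 < ρ ∧ ball (chartAt E x x) ρ ⊆ (chartAt E x).target ∧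
      AnalyticOnNhd ℂ f (ball (chartAt E x x) ρ) ∧
      (∀ p ∈ ball (chartAt E x x) ρ, (chartAt E x).symm p ∈ Zᶜ ↔ f p ≠ 0) ∧
      ∃ p ∈ ball (chartAt E x x) ρ, f p ≠ 0 := by
  obtain ⟨f, hf, hne, hfZ⟩ := hZ x
  have hfnhds := (contMDiffAt_iff_contMDiffAt_nhds (by simp)).1 hf
  obtain ⟨ρ, hρ, hball⟩ := Metric.eventually_nhds_iff_ball.1
    ((eventually_comp_chartAt_symm (E := E) x (hfnhds.and hfZ)).and
      ((chartAt E x).open_target.mem_nhds (mem_chart_target E x)))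
  refine ⟨f ∘ (chartAt E x).symm, ρ, hρ, fun p hp => (hball p hp).2,
    fun p hp => analyticAt_comp_chartAt_symm x (hball p hp).2 (hball p hp).1.1,
    fun p hp => not_congr (hball p hp).1.2, ?_⟩
  by_contra! h
  refine hne (eventually_of_eventually_comp_chartAt_symm (E := E) x ?_)
  filter_upwards [ball_mem_nhds _ hρ] with p hp using h p hp

lemma IsHypersurface.isPreconnected_compl [IsManifold 𝓘(ℂ, E) ω X] [PreconnectedSpace X]
    (hZ : IsHypersurface E Z) : IsPreconnected Zᶜ := by
  refine isPreconnected_of_forall_nhds isPreconnected_univ (subset_univ _)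
    (fun x _ => hZ.dense_compl x) fun x _ => ?_
  obtain ⟨f, ρ, hρ, htarget, hf, hfZ, -⟩ := hZ.exists_equation x
  refine ⟨(chartAt E x).symm '' ball (chartAt E x x) ρ, ?_, ?_⟩
  · refine eventually_of_eventually_comp_chartAt_symm (E := E) x
      (p := fun x' => x' ∈ (chartAt E x).symm '' ball (chartAt E x x) ρ) ?_
    filter_upwards [ball_mem_nhds _ hρ] with p hp using mem_image_of_mem _ hp
  · have : (chartAt E x).symm '' ball (chartAt E x x) ρ ∩ Zᶜ =
        (chartAt E x).symm '' {p ∈ ball (chartAt E x x) ρ | f p ≠ 0} := by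
      ext z
      constructor
      · rintro ⟨⟨p, hp, rfl⟩, hz⟩
        exact ⟨p, ⟨hp, (hfZ p hp).1 hz⟩, rfl⟩
      · rintro ⟨p, ⟨hp, hfp⟩, rfl⟩
        exact ⟨⟨p, hp, rfl⟩, (hfZ p hp).2 hfp⟩
    rw [this]
    exact (isPreconnected_ne_zero_of_analyticOnNhd isOpen_ball (convex_ball _ _) hf).image _
      ((chartAt E x).continuousOn_symm.mono fun p hp => htarget hp.1)

variable (E) in
/-- The function `φ`, defined off `Z`, has at most logarithmic singularities along `Z`: along any
holomorphic disc which meets `Z` at the isolated parameter `c` only, the derivative of `φ` has at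
most a simple pole at `c`. -/
def HasLogSingularities (Z : Set X) (φ : X → ℂ) : Prop :=
  ∀ (γ : ℂ → X) (c : ℂ), ContMDiffAt 𝓘(ℂ, ℂ) 𝓘(ℂ, E) ω γ c → (∀ᶠ t in 𝓝[≠] c, γ t ∈ Zᶜ) →
    deriv (φ ∘ γ) =O[𝓝[≠] c] fun t => (t - c)⁻¹

/-- Near any point `x` of `X`, a single-valued function with logarithmic singularities along `Z` is
bounded by its values on a compact subset of the complement of `Z`, namely a circle in a disc
through `x`. -/
lemma IsHypersurface.exists_isCompact_norm_le [IsManifold 𝓘(ℂ, E) ω X] (hZ : IsHypersurface E Z)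
    {φ : X → ℂ} (hφ : ∀ y ∈ Zᶜ, MDifferentiableAt 𝓘(ℂ, E) 𝓘(ℂ, ℂ) φ y)
    (hlog : HasLogSingularities E Z φ) (x : X) :
    ∃ K : Set X, IsCompact K ∧ K.Nonempty ∧ K ⊆ Zᶜ ∧
      ∀ C : ℝ, (∀ y ∈ K, ‖φ y‖ < C) → ∀ᶠ x' in 𝓝 x, x' ∈ Zᶜ → ‖φ x'‖ ≤ C := by
  obtain ⟨f, ρ, hρ, htarget, hf, hfZ, p, hp, hfp⟩ := hZ.exists_equation x
  set a := chartAt E x x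
  set ψ := (chartAt E x).symm
  -- parallel discs, in the direction of a point where the local equation does not vanish
  let L : E → ℂ → E := fun v t => v + t • (p - a)
  have hL : Continuous fun q : E × ℂ => L q.1 q.2 := by fun_prop
  have hLa : ∀ v, AnalyticOnNhd ℂ (L v) univ := fun v t _ => by fun_prop
  -- the zeros of the local equation on a disc on which it does not vanish identically
  have hisol : ∀ v t₀, L v t₀ ∈ ball a ρ → f (L v t₀) ≠ 0 → ∀ t, L v t ∈ ball a ρ →
      ∀ᶠ s in 𝓝[≠] t, L v s ∈ ball a ρ ∧ f (L v s) ≠ 0 := by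
    intro v t₀ ht₀ hft₀ t ht
    have hD : Convex ℝ (L v ⁻¹' ball a ρ) := by
      intro b hb c hc s s' hs hs' hss
      have : L v (s • b + s' • c) = s • L v b + s' • L v c := by
        have hp' : v = s • v + s' • v := by rw [← add_smul, hss, one_smul]
        simp only [L, add_smul, smul_add, smul_assoc]
        nth_rw 1 [hp']
        abel
      rw [mem_preimage, this]
      exact convex_ball a ρ hb hc hs hs' hss
    have hg : AnalyticOnNhd ℂ (f ∘ L v) (L v ⁻¹' ball a ρ) :=
      hf.comp ((hLa v).mono (subset_univ _)) fun t ht => ht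
    have hLv : Continuous (L v) := by fun_prop
    refine Eventually.and (mem_nhdsWithin_of_mem_nhds ((isOpen_ball.preimage hLv).mem_nhds ht)) ?_
    by_contra h
    exact hft₀ (hg.eqOn_zero_of_preconnected_of_frequently_eq_zero hD.isPreconnected ht
      ((not_eventually.1 h).mono fun z hz => not_not.1 hz) ht₀)
  have ha : a ∈ ball a ρ := mem_ball_self hρ
  have hL0 : ∀ v, L v 0 = v := fun v => by simp [L]
  obtain ⟨r, hr, hrball⟩ := Metric.eventually_nhds_iff_ball.1 (eventually_nhdsWithin_iff.1
    (hisol a 1 (by simpa [L] using hp) (by simpa [L] using hfp) 0 (by simpa [hL0] using ha)))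
  have hLclosed : ∀ t ∈ closedBall (0 : ℂ) (r / 2), L a t ∈ ball a ρ := by
    intro t ht
    by_cases h0 : t = 0
    · rw [h0, hL0]; exact ha
    · exact (hrball t (closedBall_subset_ball (half_lt_self hr) ht) h0).1
  have hLsphere : ∀ t ∈ sphere (0 : ℂ) (r / 2), f (L a t) ≠ 0 := fun t ht =>
    (hrball t (sphere_subset_ball (half_lt_self hr) ht)
      (ne_of_mem_sphere ht (half_pos hr).ne')).2
  have hψ : ∀ q ∈ ball a ρ, ContinuousAt ψ q := fun q hq =>
    (chartAt E x).continuousAt_symm (htarget hq)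
  refine ⟨(ψ ∘ L a) '' sphere 0 (r / 2), (isCompact_sphere _ _).image_of_continuousOn ?_,
    (NormedSpace.sphere_nonempty.2 (half_pos hr).le).image _, ?_, ?_⟩
  · intro t ht
    exact ((hψ _ (hLclosed t (sphere_subset_closedBall ht))).comp (f := L a)
      (by fun_prop)).continuousWithinAt
  · rintro _ ⟨t, ht, rfl⟩
    exact (hfZ _ (hLclosed t (sphere_subset_closedBall ht))).2 (hLsphere t ht)
  intro C hC
  refine eventually_of_eventually_comp_chartAt_symm (E := E) x ?_
  have h1 : ∀ᶠ v in 𝓝 a, ∀ t ∈ closedBall (0 : ℂ) (r / 2), L v t ∈ ball a ρ := by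
    refine (isCompact_closedBall _ _).eventually_forall_of_forall_eventually fun t ht => ?_
    exact hL.continuousAt.eventually (isOpen_ball.mem_nhds (hLclosed t ht))
  have h2 : ∀ᶠ v in 𝓝 a, ∀ t ∈ sphere (0 : ℂ) (r / 2), f (L v t) ≠ 0 ∧ ‖φ (ψ (L v t))‖ < C := by
    refine (isCompact_sphere _ _).eventually_forall_of_forall_eventually fun t ht => ?_
    have hLt := hLclosed t (sphere_subset_closedBall ht)
    have e1 : ContinuousAt (fun q : E × ℂ => f (L q.1 q.2)) (a, t) :=
      (hf _ hLt).continuousAt.comp (f := fun q : E × ℂ => L q.1 q.2) hL.continuousAt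
    have e2 : ContinuousAt (fun q : E × ℂ => φ (ψ (L q.1 q.2))) (a, t) := by
      refine ContinuousAt.comp (g := φ) ?_
        ((hψ _ hLt).comp (f := fun q : E × ℂ => L q.1 q.2) hL.continuousAt)
      exact (hφ _ ((hfZ _ hLt).2 (hLsphere t ht))).continuousAt
    exact (e1.eventually_ne (hLsphere t ht)).and
      (e2.norm.eventually (gt_mem_nhds (hC _ (mem_image_of_mem _ ht))))
  filter_upwards [h1, h2] with v hv1 hv2 hvZ
  have hr2 : (0 : ℝ) < r / 2 := half_pos hr
  have hv0 : L v 0 ∈ ball a ρ := hv1 0 (mem_closedBall_self hr2.le)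
  have hfv0 : f (L v 0) ≠ 0 := by
    rw [← hfZ _ hv0, hL0]
    exact hvZ
  have hγ : ∀ t, L v t ∈ ball a ρ → ContMDiffAt 𝓘(ℂ, ℂ) 𝓘(ℂ, E) ω (ψ ∘ L v) t := fun t ht =>
    (contMDiffAt_chartAt_symm x (htarget ht)).comp t
      ((show ContDiff ℂ ω (L v) by fun_prop).contMDiff.contMDiffAt)
  have hd : ∀ t, L v t ∈ ball a ρ → f (L v t) ≠ 0 → DifferentiableAt ℂ (φ ∘ ψ ∘ L v) t :=
    fun t ht hft => ((hφ _ ((hfZ _ ht).2 hft)).comp t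
      ((hγ t ht).mdifferentiableAt (by simp))).differentiableAt
  have := norm_center_le_of_deriv_isBigO (F := φ ∘ ψ ∘ L v) hr2 (C := C) ?_ ?_ ?_ ?_ ?_
  · simpa [hL0] using this
  · intro c hc
    filter_upwards [hisol v 0 hv0 hfv0 c (hv1 c hc)] with t ht using hd t ht.1 ht.2
  · intro c hc
    refine hlog _ c (hγ c (hv1 c hc)) ?_
    filter_upwards [hisol v 0 hv0 hfv0 c (hv1 c hc)] with t ht using (hfZ _ ht.1).2 ht.2
  · exact (hd 0 hv0 hfv0).continuousAt
  · exact fun t ht => (hd t (hv1 t (sphere_subset_closedBall ht)) (hv2 t ht).1).continuousAt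
  · exact fun t ht => (hv2 t ht).2.le

/-- On a compact connected manifold, a single-valued holomorphic function on the complement of `Z`
with logarithmic singularities along `Z` is locally constant. -/
lemma IsHypersurface.eventually_eq_of_hasLogSingularities [IsManifold 𝓘(ℂ, E) ω X]
    [CompactSpace X] [ConnectedSpace X] (hZ : IsHypersurface E Z)
    {φ : X → ℂ} (hφ : ∀ y ∈ Zᶜ, MDifferentiableAt 𝓘(ℂ, E) 𝓘(ℂ, ℂ) φ y)
    (hlog : HasLogSingularities E Z φ) : ∀ y ∈ Zᶜ, ∀ᶠ x in 𝓝 y, φ x = φ y := by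
  -- the modulus of `φ` attains its maximum
  obtain ⟨y₀, hy₀, hmax⟩ : ∃ y₀ ∈ Zᶜ, ∀ y ∈ Zᶜ, ‖φ y‖ ≤ ‖φ y₀‖ := by
    by_contra! hno
    have hloc : ∀ x : X, ∃ y ∈ Zᶜ, ∀ᶠ x' in 𝓝 x, x' ∈ Zᶜ → ‖φ x'‖ ≤ ‖φ y‖ := by
      intro x
      obtain ⟨K, hK, hKne, hKZ, hbound⟩ := hZ.exists_isCompact_norm_le hφ hlog x
      obtain ⟨k, hk, hkmax⟩ := hK.exists_isMaxOn hKne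
        (f := fun y => ‖φ y‖) fun y hy => (hφ y (hKZ hy)).continuousAt.norm.continuousWithinAt
      obtain ⟨y, hy, hlt⟩ := hno k (hKZ hk)
      exact ⟨y, hy, hbound _ fun z hz => (hkmax hz).trans_lt hlt⟩
    choose b hb hbound using hloc
    obtain ⟨t, ht⟩ := CompactSpace.elim_nhds_subcover _ hbound
    have htne : t.Nonempty := by
      by_contra h
      rw [Finset.not_nonempty_iff_eq_empty] at h
      subst h
      obtain ⟨x⟩ := (inferInstance : Nonempty X)
      have hx : x ∈ (⊤ : Set X) := trivial
      rw [← ht] at hx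
      simp at hx
    obtain ⟨x₁, -, hx₁⟩ := t.exists_max_image (fun x => ‖φ (b x)‖) htne
    obtain ⟨y, hy, hlt⟩ := hno (b x₁) (hb x₁)
    have hy' : y ∈ (⊤ : Set X) := trivial
    rw [← ht] at hy'
    obtain ⟨x₂, hx₂, hyx⟩ := mem_iUnion₂.1 hy'
    exact absurd ((hyx hy).trans (hx₁ x₂ hx₂)) (not_le.2 hlt)
  have hopen := hZ.isOpen_compl
  have hkey : ∀ y ∈ Zᶜ, ‖φ y‖ = ‖φ y₀‖ → ∀ᶠ x in 𝓝 y, φ x = φ y := by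
    intro y hy hyy
    refine eventually_eq_of_eventually_norm_le (E := E) ?_ ?_
    · filter_upwards [hopen.mem_nhds hy] with x hx using hφ x hx
    · filter_upwards [hopen.mem_nhds hy] with x hx using (hmax x hx).trans hyy.ge
  intro y hy
  refine hkey y hy ?_
  refine (iff_of_isPreconnected hZ.isPreconnected_compl
    (P := fun y => ‖φ y‖ = ‖φ y₀‖) (fun y hy => ?_) hy₀ hy).1 rfl
  by_cases hyy : ‖φ y‖ = ‖φ y₀‖
  · filter_upwards [hkey y hy hyy] with x hx
    rw [hx]
  · filter_upwards [(hφ y hy).continuousAt.norm.eventually_ne hyy] with x hx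
    exact iff_of_false hx hyy

end Hypersurface

end HyperlogWeb

namespace HyperlogWeb

open Filter Set Metric Asymptotics

/-! ### Pull-backs of logarithmic forms -/

lemma ofAffine_affCoord {p : ProjSpace 1} (hp : p ≠ infPt) : ofAffine (affCoord p) = p := by
  induction p using Projectivization.ind with
  | h v hv =>
    have h1 : v 1 ≠ 0 := by
      intro h1
      refine hp ?_
      rw [infPt, Projectivization.mk_eq_mk_iff']
      refine ⟨v 0, ?_⟩
      ext k
      fin_cases k <;> simp [h1]
    rw [ofAffine, Projectivization.mk_eq_mk_iff']
    refine ⟨(v 1)⁻¹, ?_⟩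
    ext k
    fin_cases k
    · simp [affCoord, div_eq_inv_mul]
    · simp [h1]

lemma affCoord_notMem_finPart {X : Type*} {Z : Set X} {U : X → ProjSpace 1}
    (hinf : infPt ∈ branchLocus Zᶜ U) {y : X} (hy : y ∈ Zᶜ) :
    affCoord (U y) ∉ finPart (branchLocus Zᶜ U) := by
  intro h
  rw [finPart, mem_ofPred_eq, ofAffine_affCoord fun h => hinf ⟨y, hy, h⟩] at h
  exact h ⟨y, hy, rfl⟩

lemma finite_finPart {B : Set (ProjSpace 1)} (hB : B.Finite) : (finPart B).Finite :=
  hB.preimage (Function.LeftInverse.injective affCoord_ofAffine).injOn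

section PullBack

variable {E : Type*} [NormedAddCommGroup E] [NormedSpace ℂ E]
  {X : Type*} [TopologicalSpace X] [ChartedSpace E X] {Z : Set X} {U : X → ProjSpace 1}

lemma affCoord_eventuallyEq {F : X → Fin 2 → ℂ} {x : X} (hF : IsHolomorphicLiftAt (E := E) U F x) :
    (fun x' => affCoord (U x')) =ᶠ[𝓝 x] fun x' => F x' 0 / F x' 1 := by
  filter_upwards [hF.2] with x' ⟨h0, hx'⟩
  rw [hx']
  rfl

lemma IsHolomorphicLiftAt.contMDiffAt_apply {F : X → Fin 2 → ℂ} {x : X}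
    (hF : IsHolomorphicLiftAt (E := E) U F x) (k : Fin 2) :
    ContMDiffAt 𝓘(ℂ, E) 𝓘(ℂ, ℂ) ω (fun x' => F x' k) x :=
  (show ContDiff ℂ ω fun v : Fin 2 → ℂ => v k by fun_prop).contMDiff.contMDiffAt.comp x hF.1

/-- Off `Z`, where `U` avoids `∞`, its affine coordinate is holomorphic. -/
lemma IsHolomorphicToProj.contMDiffAt_affCoord (hU : IsHolomorphicToProj E U)
    (hinf : infPt ∈ branchLocus Zᶜ U) {y : X} (hy : y ∈ Zᶜ) :
    ContMDiffAt 𝓘(ℂ, E) 𝓘(ℂ, ℂ) ω (fun x => affCoord (U x)) y := by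
  obtain ⟨F, hF⟩ := hU y
  have h1 : F y 1 ≠ 0 := by
    intro h1
    obtain ⟨h0, hUy⟩ := hF.2.self_of_nhds
    refine hinf ⟨y, hy, ?_⟩
    rw [hUy, infPt, Projectivization.mk_eq_mk_iff']
    refine ⟨F y 0, ?_⟩
    ext k
    fin_cases k <;> simp [h1]
  refine ContMDiffAt.congr_of_eventuallyEq ?_ (affCoord_eventuallyEq hF)
  exact (hF.contMDiffAt_apply 0).div₀ (hF.contMDiffAt_apply 1) h1

lemma IsHolomorphicToProj.meromorphicAt_comp (hU : IsHolomorphicToProj E U) {γ : ℂ → X} {c : ℂ}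
    (hγ : ContMDiffAt 𝓘(ℂ, ℂ) 𝓘(ℂ, E) ω γ c) : MeromorphicAt (fun t => affCoord (U (γ t))) c := by
  obtain ⟨F, hF⟩ := hU (γ c)
  have h : ∀ k, AnalyticAt ℂ (fun t => F (γ t) k) c := fun k =>
    ((hF.contMDiffAt_apply k).comp c hγ).contDiffAt.analyticAt
  refine ((h 0).meromorphicAt.div (h 1).meromorphicAt).congr ?_
  have := hγ.continuousAt.tendsto.eventually (affCoord_eventuallyEq hF)
  exact (this.mono fun t ht => ht.symm).filter_mono nhdsWithin_le_nhds

lemma hasDerivAt_comp_of_hasMFDerivAt {φ : X → ℂ} {γ : ℂ → X} {t : ℂ}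
    {L : TangentSpace 𝓘(ℂ, E) (γ t) →L[ℂ] ℂ} (hφ : HasMFDerivAt 𝓘(ℂ, E) 𝓘(ℂ, ℂ) φ (γ t) L)
    (hγ : MDifferentiableAt 𝓘(ℂ, ℂ) 𝓘(ℂ, E) γ t) :
    HasDerivAt (φ ∘ γ) (L (mfderiv 𝓘(ℂ, ℂ) 𝓘(ℂ, E) γ t (1 : ℂ))) t := by
  have h := (hφ.comp t hγ.hasMFDerivAt).hasFDerivAt
  rw [hasDerivAt_iff_hasFDerivAt]
  refine h.congr_fderiv ?_
  exact ContinuousLinearMap.ext_ring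
    (one_smul ℂ (L (mfderiv 𝓘(ℂ, ℂ) 𝓘(ℂ, E) γ t (1 : ℂ)) : ℂ)).symm

open scoped Classical in
variable (E) in
/-- The pull-back of a 1-form on the complement of `Z` under a map `γ` from `ℂ`, as the coefficient
of `dt` (and `0` where `γ` meets `Z`). -/
noncomputable def discPullback (Z : Set X) (γ : ℂ → X) (h : OneForm E Zᶜ) (t : ℂ) : ℂ :=
  if ht : γ t ∈ Zᶜ then h ⟨γ t, ht⟩ (mfderiv 𝓘(ℂ, ℂ) 𝓘(ℂ, E) γ t (1 : ℂ)) else 0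

lemma discPullback_pullback_isBigO [IsManifold 𝓘(ℂ, E) ω X] (hU : IsHolomorphicToProj E U)
    (hinf : infPt ∈ branchLocus Zᶜ U) (hfin : (branchLocus Zᶜ U).Finite)
    (f : LogFormsOf Zᶜ U) {γ : ℂ → X} {c : ℂ} (hγ : ContMDiffAt 𝓘(ℂ, ℂ) 𝓘(ℂ, E) ω γ c)
    (hγZ : ∀ᶠ t in 𝓝[≠] c, γ t ∈ Zᶜ) :
    discPullback E Z γ (pullback E Zᶜ U f) =O[𝓝[≠] c] fun t => (t - c)⁻¹ := by
  refine (logForms_comp_isBigO (finite_finPart hfin).isClosed f (hU.meromorphicAt_comp hγ)).congr'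
    ?_ EventuallyEq.rfl
  filter_upwards [hγZ, ((contMDiffAt_iff_contMDiffAt_nhds (by simp)).1 hγ).filter_mono
    nhdsWithin_le_nhds] with t ht hγt
  have h1 := ((hU.contMDiffAt_affCoord hinf ht).mdifferentiableAt (by simp)).hasMFDerivAt
  have h2 := hasDerivAt_comp_of_hasMFDerivAt h1 (hγt.mdifferentiableAt (by simp))
  rw [discPullback, dif_pos ht]
  exact congrArg _ h2.deriv

/-- A function on the complement of `Z` whose differential is a sum of pull-backs of logarithmic
forms has logarithmic singularities along `Z`. -/
lemma hasLogSingularities_of_hasMFDerivAt [IsManifold 𝓘(ℂ, E) ω X] {d : ℕ}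
    {U : Fin d → X → ProjSpace 1} (hU : ∀ i, IsHolomorphicToProj E (U i))
    (hinf : ∀ i, infPt ∈ branchLocus Zᶜ (U i)) (hfin : ∀ i, (branchLocus Zᶜ (U i)).Finite)
    {h : OneForm E Zᶜ} (hh : h ∈ totalForms E Zᶜ U) {φ : X → ℂ}
    (hφ : ∀ y : (Zᶜ : Set X), HasMFDerivAt 𝓘(ℂ, E) 𝓘(ℂ, ℂ) φ (y : X) (h y)) :
    HasLogSingularities E Z φ := by
  intro γ c hγ hγZ
  have key : discPullback E Z γ h =O[𝓝[≠] c] fun t => (t - c)⁻¹ := by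
    refine Submodule.iSup_induction _
      (motive := fun h => discPullback E Z γ h =O[𝓝[≠] c] fun t => (t - c)⁻¹) hh ?_ ?_ ?_
    · rintro i _ ⟨f, rfl⟩
      exact discPullback_pullback_isBigO (hU i) (hinf i) (hfin i) f hγ hγZ
    · refine (isBigO_zero _ _).congr_left fun t => ?_
      rw [discPullback]
      split_ifs <;> rfl
    · intro h₁ h₂ hh₁ hh₂
      refine (hh₁.add hh₂).congr_left fun t => ?_
      simp only [discPullback]
      split_ifs
      · rfl
      · exact add_zero _
  refine key.congr' ?_ EventuallyEq.rfl
  filter_upwards [hγZ, ((contMDiffAt_iff_contMDiffAt_nhds (by simp)).1 hγ).filter_mono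
    nhdsWithin_le_nhds] with t ht hγt
  rw [discPullback, dif_pos ht]
  exact (hasDerivAt_comp_of_hasMFDerivAt (hφ ⟨γ t, ht⟩)
    (hγt.mdifferentiableAt (by simp))).deriv.symm

/-- A sum of pull-backs of logarithmic forms which is exact on the complement of `Z` vanishes. -/
lemma eq_zero_of_hasMFDerivAt [IsManifold 𝓘(ℂ, E) ω X] [CompactSpace X] [ConnectedSpace X]
    (hZ : IsHypersurface E Z) {d : ℕ}
    {U : Fin d → X → ProjSpace 1} (hU : ∀ i, IsHolomorphicToProj E (U i))
    (hinf : ∀ i, infPt ∈ branchLocus Zᶜ (U i)) (hfin : ∀ i, (branchLocus Zᶜ (U i)).Finite)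
    {h : OneForm E Zᶜ} (hh : h ∈ totalForms E Zᶜ U) {φ : X → ℂ}
    (hφ : ∀ y : (Zᶜ : Set X), HasMFDerivAt 𝓘(ℂ, E) 𝓘(ℂ, ℂ) φ (y : X) (h y)) : h = 0 := by
  ext1 y
  have h1 := hZ.eventually_eq_of_hasLogSingularities
    (fun y hy => (hφ ⟨y, hy⟩).mdifferentiableAt)
    (hasLogSingularities_of_hasMFDerivAt hU hinf hfin hh hφ) y y.2
  exact hasMFDerivAt_unique (hφ y)
    ((hasMFDerivAt_const (φ y) (y : X)).congr_of_eventuallyEq h1)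

end PullBack

end HyperlogWeb

namespace HyperlogWeb

open Filter Set Metric Asymptotics

/-! ### Symbols of combinations of words -/

section Symbol

variable {ι κ μ : Type*}

/-- The coefficient of the word `J` in the tensor obtained from the word `w` by substituting
`∑ j, α k j • j` for each letter `k`. -/
def substCoeff (α : κ → μ → ℂ) : List κ → List μ → ℂ
  | [], [] => 1
  | k :: w, j :: J => α k j * substCoeff α w J
  | [], _ :: _ => 0
  | _ :: _, [] => 0

lemma substCoeff_eq_zero (α : κ → μ → ℂ) : ∀ (w : List κ) (J : List μ), w.length ≠ J.length →
    substCoeff α w J = 0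
  | [], [], h => absurd rfl h
  | k :: w, j :: J, h => by
    rw [substCoeff, substCoeff_eq_zero α w J (by simpa using h), mul_zero]
  | [], _ :: _, _ => rfl
  | _ :: _, [], _ => rfl

lemma substCoeff_append (α : κ → μ → ℂ) : ∀ (w : List κ) (J J' : List μ),
    substCoeff α w (J ++ J') =
      substCoeff α (w.take J.length) J * substCoeff α (w.drop J.length) J'
  | w, [], J' => by simp [substCoeff]
  | [], j :: J, J' => by simp [substCoeff]
  | k :: w, j :: J, J' => by
    simp [substCoeff, substCoeff_append α w J J', mul_assoc]

lemma substCoeff_ofFn (α : κ → μ → ℂ) : ∀ {n : ℕ} (w : Fin n → κ) (J : Fin n → μ),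
    substCoeff α (List.ofFn w) (List.ofFn J) = ∏ t, α (w t) (J t)
  | 0, w, J => by simp [substCoeff]
  | n + 1, w, J => by
    rw [List.ofFn_succ, List.ofFn_succ, substCoeff, substCoeff_ofFn, Fin.prod_univ_succ]

/-- The symbol of a formal combination of words in the alphabets indexed by `ι`, as the family of
its coefficients on the words in the common alphabet `μ`. -/
noncomputable def symbol (α : ι → κ → μ → ℂ) : (ι × List κ →₀ ℂ) →ₗ[ℂ] (List μ → ℂ) :=
  Finsupp.linearCombination ℂ fun p => substCoeff (α p.1) p.2

/-- Formal combinations of words of length less than `n`. -/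
def wordsLT (ι κ : Type*) (n : ℕ) : Submodule ℂ (ι × List κ →₀ ℂ) :=
  Finsupp.supported ℂ ℂ {p | p.2.length < n}

lemma symbol_eq_zero_of_length (α : ι → κ → μ → ℂ) {a : ι × List κ →₀ ℂ} {J : List μ}
    (h : ∀ p ∈ a.support, p.2.length ≠ J.length) : symbol α a J = 0 := by
  rw [symbol, Finsupp.linearCombination_apply, Finsupp.sum, Finset.sum_apply]
  refine Finset.sum_eq_zero fun p hp => ?_
  rw [Pi.smul_apply, substCoeff_eq_zero _ _ _ (h p hp), smul_zero]

/-- Remove the first letter of a word, weighted by the coefficient of `j` in this letter. -/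
noncomputable def stripWord (α : ι → κ → μ → ℂ) (j : μ) : ι × List κ → (ι × List κ →₀ ℂ)
  | (_, []) => 0
  | (i, k :: w) => Finsupp.single (i, w) (α i k j)

/-- The linear extension of `stripWord`, which lifts to words the contraction of a symbol
`∑ j, j ⊗ T j` to `T j`. -/
noncomputable def strip (α : ι → κ → μ → ℂ) (j : μ) :
    (ι × List κ →₀ ℂ) →ₗ[ℂ] (ι × List κ →₀ ℂ) :=
  Finsupp.linearCombination ℂ (stripWord α j)

lemma symbol_strip (α : ι → κ → μ → ℂ) (j : μ) (a : ι × List κ →₀ ℂ) (J : List μ) :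
    symbol α (strip α j a) J = symbol α a (j :: J) := by
  induction a using Finsupp.induction_linear with
  | zero => simp
  | add a b ha hb => simp only [map_add, Pi.add_apply, ha, hb]
  | single p c =>
    obtain ⟨i, _ | ⟨k, w⟩⟩ := p <;>
      simp only [strip, stripWord, symbol, Finsupp.linearCombination_single, map_smul, map_zero,
        Pi.smul_apply, Pi.zero_apply, smul_eq_mul, substCoeff, mul_zero]

lemma linearCombination_mem_wordsLT {f : ι × List κ → (ι × List κ →₀ ℂ)} {n n' : ℕ}
    (hf : ∀ p : ι × List κ, p.2.length < n → f p ∈ wordsLT ι κ n') {a : ι × List κ →₀ ℂ}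
    (ha : a ∈ wordsLT ι κ n) : Finsupp.linearCombination ℂ f a ∈ wordsLT ι κ n' := by
  rw [Finsupp.linearCombination_apply]
  exact Submodule.sum_mem _ fun p hp => Submodule.smul_mem _ _
    (hf p ((Finsupp.mem_supported ℂ a).1 ha hp))

lemma strip_mem_wordsLT (α : ι → κ → μ → ℂ) (j : μ) {n : ℕ} {a : ι × List κ →₀ ℂ}
    (ha : a ∈ wordsLT ι κ (n + 1)) : strip α j a ∈ wordsLT ι κ n := by
  refine linearCombination_mem_wordsLT (fun p hp => ?_) ha
  obtain ⟨i, _ | ⟨k, w⟩⟩ := p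
  · exact Submodule.zero_mem _
  · exact Finsupp.single_mem_supported ℂ _ (by simpa using hp)

end Symbol

/-! ### Pulled-back hyperlogarithms and their symbols -/

variable {E : Type*} [NormedAddCommGroup E] [NormedSpace ℂ E]
  {X : Type*} [TopologicalSpace X] [ChartedSpace E X] {Y : Set X}

variable (E) in
/-- Covectors of the model space `E`. This copy of the space of continuous linear forms is a
definition rather than an abbreviation, so that only its module structure is visible. -/
def Covector : Type _ := E →L[ℂ] ℂ

noncomputable instance : AddCommGroup (Covector E) := inferInstanceAs (AddCommGroup (E →L[ℂ] ℂ))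

noncomputable instance : Module ℂ (Covector E) := inferInstanceAs (Module ℂ (E →L[ℂ] ℂ))

/-- The differential of `φ` at `x` as a covector of the model space. -/
noncomputable def differential (φ : X → ℂ) (x : X) : Covector E :=
  mfderiv 𝓘(ℂ, E) 𝓘(ℂ, ℂ) φ x

/-- The differential of `φ` at `x`, read in the model space, is `L`. -/
def HasDifferential (φ : X → ℂ) (x : X) (L : Covector E) : Prop :=
  HasMFDerivAt 𝓘(ℂ, E) 𝓘(ℂ, ℂ) φ x L

namespace HasDifferential

variable {φ χ : X → ℂ} {x : X} {L M : Covector E}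

lemma const (c : ℂ) (x : X) : HasDifferential (E := E) (fun _ => c) x 0 :=
  hasMFDerivAt_const c x

lemma congr_of_eventuallyEq (h : HasDifferential φ x L) (h' : χ =ᶠ[𝓝 x] φ) :
    HasDifferential χ x L :=
  HasMFDerivAt.congr_of_eventuallyEq h h'

lemma add (h : HasDifferential φ x L) (h' : HasDifferential χ x M) :
    HasDifferential (φ + χ) x (L + M) :=
  HasMFDerivAt.add h h'

lemma const_smul (h : HasDifferential φ x L) (c : ℂ) : HasDifferential (c • φ) x (c • L) :=
  HasMFDerivAt.const_smul h c

lemma sum {β : Type*} {s : Finset β} {φ : β → X → ℂ} {L : β → Covector E}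
    (h : ∀ b ∈ s, HasDifferential (φ b) x (L b)) :
    HasDifferential (∑ b ∈ s, φ b) x (∑ b ∈ s, L b) := by
  classical
  induction s using Finset.induction_on with
  | empty => exact const 0 x
  | insert b s hb ih =>
    rw [Finset.sum_insert hb, Finset.sum_insert hb]
    exact (h b (Finset.mem_insert_self b s)).add
      (ih fun b' hb' => h b' (Finset.mem_insert_of_mem hb'))

lemma scomp {g : ℂ → ℂ} {g' : ℂ} (hg : HasDerivAt g g' (φ x)) (h : HasDifferential φ x L) :
    HasDifferential (g ∘ φ) x (g' • L) := by
  refine (hg.hasFDerivAt.hasMFDerivAt.comp x h).congr_mfderiv ?_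
  exact ContinuousLinearMap.ext fun v => mul_comm ((show E →L[ℂ] ℂ from L) v) g'

end HasDifferential

lemma hasDifferential_differential {φ : X → ℂ} {x : X}
    (h : ContMDiffAt 𝓘(ℂ, E) 𝓘(ℂ, ℂ) ω φ x) :
    HasDifferential φ x (differential (E := E) φ x) :=
  (h.mdifferentiableAt (by simp)).hasMFDerivAt

variable (E) in
/-- Finitely many holomorphic functions `u i` on an open set `Y`, each avoiding a closed set `S i`,
logarithmic forms `ν i k` with poles in `S i`, and 1-forms `h j` on `Y` of which the pull-backs
`(u i)^* (ν i k)` are the combinations with coefficients `α i k j`. The last axiom is the global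
input: no nontrivial combination of the `h j` is the differential of a single-valued function. -/
structure WordSystem (Y : Set X) (ι κ μ : Type*) [Fintype μ] where
  /-- the maps to the affine line -/
  u : ι → X → ℂ
  /-- the poles of the logarithmic forms -/
  S : ι → Set ℂ
  /-- the logarithmic forms -/
  ν : ∀ i, κ → logForms (S i)
  /-- the coefficients of the pull-backs -/
  α : ι → κ → μ → ℂ
  /-- the 1-forms on `Y` -/
  h : μ → Y → Covector E
  isOpen : IsOpen Y
  isClosed : ∀ i, IsClosed (S i)
  notMem : ∀ i, ∀ y ∈ Y, u i y ∉ S i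
  contMDiffAt : ∀ i, ∀ y ∈ Y, ContMDiffAt 𝓘(ℂ, E) 𝓘(ℂ, ℂ) ω (u i) y
  pullback_eq : ∀ i k, ∀ y : Y,
    (ν i k).1 (u i y) • differential (u i) (y : X) = ∑ j, α i k j • h j y
  eq_zero_of_exact : ∀ (t : μ → ℂ) (φ : X → ℂ), (∀ y : Y,
    HasDifferential φ (y : X) (∑ j, t j • h j y)) → t = 0

namespace WordSystem

variable {ι κ μ : Type*} [Fintype μ] (D : WordSystem E Y ι κ μ)

/-- The pull-back under `u i` of the iterated integral along a word, with base point `u i y`. -/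
noncomputable def germ (y : X) (p : ι × List κ) (x : X) : ℂ :=
  wordIntegral (D.ν p.1) (D.u p.1 y) p.2 (D.u p.1 x)

/-- Linear extension of `germ` to combinations of words. -/
noncomputable def eval (y : X) : (ι × List κ →₀ ℂ) →ₗ[ℂ] (X → ℂ) :=
  Finsupp.linearCombination ℂ (D.germ y)

/-- The radius `r` is good at `y` if the discs with radius `r` around the points `u i y` avoid
the poles. -/
def IsRadius (y : X) (r : ℝ) : Prop :=
  ∀ i, Disjoint (ball (D.u i y) r) (D.S i)

/-- The points of `Y` whose images are `r`-close to those of `y`. -/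
def near (y : X) (r : ℝ) : Set X :=
  {x ∈ Y | ∀ i, D.u i x ∈ ball (D.u i y) r}

lemma near_mem_nhds [Finite ι] {y : X} (hy : y ∈ Y) {r : ℝ} (hr : 0 < r) : D.near y r ∈ 𝓝 y := by
  have h : ∀ᶠ x in 𝓝 y, ∀ i, D.u i x ∈ ball (D.u i y) r := eventually_all.2 fun i =>
    (D.contMDiffAt i y hy).continuousAt.eventually (ball_mem_nhds _ hr)
  filter_upwards [D.isOpen.mem_nhds hy, h] with x h1 h2 using ⟨h1, h2⟩

lemma exists_isRadius [Finite ι] {y : X} (hy : y ∈ Y) : ∃ r > 0, D.IsRadius y r := by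
  have : ∀ᶠ r in 𝓝[>] (0 : ℝ), D.IsRadius y r := by
    refine eventually_all.2 fun i => ?_
    obtain ⟨r, hr, hball⟩ := Metric.isOpen_iff.1 (D.isClosed i).isOpen_compl _ (D.notMem i y hy)
    filter_upwards [Ioo_mem_nhdsGT hr] with r' hr'
    exact disjoint_left.2 fun z hz => hball (ball_subset_ball hr'.2.le hz)
  obtain ⟨r, h1, h2⟩ := (this.and self_mem_nhdsWithin).exists
  exact ⟨r, h2, h1⟩

variable {D} in
lemma hasDifferential_germ {y : X} {r : ℝ} (hr : D.IsRadius y r) (i : ι) (k : κ) (w : List κ)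
    {x : X} (hx : x ∈ D.near y r) :
    HasDifferential (D.germ y (i, k :: w)) x
      (D.germ y (i, w) x • ∑ j, D.α i k j • D.h j ⟨x, hx.1⟩) := by
  have h := (hasDifferential_differential (D.contMDiffAt i x hx.1)).scomp
    (hasDerivAt_wordIntegral (D.ν i) (hr i) w k _ (hx.2 i))
  rw [mul_comm, mul_smul] at h
  rw [← D.pullback_eq i k ⟨x, hx.1⟩]
  exact h

variable {D} in
lemma germ_nil {y : X} {r : ℝ} (hr : D.IsRadius y r) (i : ι) {x : X} (hx : x ∈ D.near y r) :
    D.germ y (i, []) x = 1 :=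
  wordIntegral_nil (D.ν i) (hr i) (hx.2 i)

variable {D} in
/-- The differential of a combination of pulled-back iterated integrals. -/
lemma hasDifferential_eval [Finite ι] {y : X} {r : ℝ} (hr : D.IsRadius y r) {x : X}
    (hx : x ∈ D.near y r) (a : ι × List κ →₀ ℂ) :
    HasDifferential (D.eval y a) x
      (∑ j, D.eval y (strip D.α j a) x • D.h j ⟨x, hx.1⟩) := by
  have hopen : ∀ᶠ x' in 𝓝 x, x' ∈ D.near y r := by
    have h : ∀ᶠ x' in 𝓝 x, ∀ i, D.u i x' ∈ ball (D.u i y) r := eventually_all.2 fun i =>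
      (D.contMDiffAt i x hx.1).continuousAt.eventually (isOpen_ball.mem_nhds (hx.2 i))
    filter_upwards [D.isOpen.mem_nhds hx.1, h] with x h1 h2 using ⟨h1, h2⟩
  induction a using Finsupp.induction_linear with
  | zero =>
    simp only [map_zero, Pi.zero_apply, zero_smul, Finset.sum_const_zero]
    exact HasDifferential.const 0 x
  | add a b ha hb =>
    simp only [map_add, Pi.add_apply, add_smul, Finset.sum_add_distrib]
    exact ha.add hb
  | single p c =>
    obtain ⟨i, _ | ⟨k, w⟩⟩ := p
    · simp only [eval, strip, stripWord, Finsupp.linearCombination_single, smul_zero, map_zero,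
        Pi.zero_apply, zero_smul, Finset.sum_const_zero]
      refine (HasDifferential.const c x).congr_of_eventuallyEq ?_
      filter_upwards [hopen] with x' hx'
      rw [Pi.smul_apply, germ_nil hr i hx', smul_eq_mul, mul_one]
    · simp only [eval, strip, stripWord, Finsupp.linearCombination_single, map_smul,
        Pi.smul_apply, smul_eq_mul]
      have h := (hasDifferential_germ hr i k w hx).const_smul c
      simp only [Finset.smul_sum, smul_smul] at h
      convert! h using 4
      ring

lemma eval_self [Finite ι] {y : X} (hy : y ∈ Y) (a : ι × List κ →₀ ℂ) :
    D.eval y a y = symbol D.α a [] := by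
  obtain ⟨r, hr0, hr⟩ := D.exists_isRadius hy
  induction a using Finsupp.induction_linear with
  | zero => simp
  | add a b ha hb => simp only [map_add, Pi.add_apply, ha, hb]
  | single p c =>
    simp only [eval, symbol, Finsupp.linearCombination_single, Pi.smul_apply]
    congr 1
    obtain ⟨i, _ | ⟨k, w⟩⟩ := p
    · exact germ_nil hr i (mem_of_mem_nhds (D.near_mem_nhds hy hr0))
    · exact wordIntegral_cons_self (D.ν i) k w

/-- A combination of iterated integrals with zero symbol vanishes. -/
lemma eval_eventually_eq_zero [Finite ι] [IsManifold 𝓘(ℂ, E) ω X] (n : ℕ) :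
    ∀ a ∈ wordsLT ι κ n, symbol D.α a = 0 → ∀ y ∈ Y, ∀ᶠ x in 𝓝 y, D.eval y a x = 0 := by
  induction n with
  | zero =>
    intro a ha _ y _
    have : a = 0 := by simpa [wordsLT] using ha
    simp [this]
  | succ n ih =>
    intro a ha hsym y hy
    obtain ⟨r, hr0, hr⟩ := D.exists_isRadius hy
    have h1 : ∀ᶠ x in 𝓝 y, ∀ j, D.eval y (strip D.α j a) x = 0 := eventually_all.2 fun j => by
      refine ih _ (strip_mem_wordsLT D.α j ha) ?_ y hy
      ext J
      rw [symbol_strip, hsym]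
      rfl
    have h2 : ∀ᶠ x in 𝓝 y, HasDifferential (D.eval y a) x (0 : Covector E) := by
      filter_upwards [h1, D.near_mem_nhds hy hr0] with x hx1 hx2
      simpa only [hx1, zero_smul, Finset.sum_const_zero] using hasDifferential_eval hr hx2 a
    filter_upwards [eventually_eq_of_hasMFDerivAt_zero h2] with x hx
    rw [hx, D.eval_self hy, hsym]
    rfl

/-- Change of base point from `y` to `y'` on words, see `wordIntegral_changeBase`. -/
noncomputable def shift (y y' : X) : (ι × List κ →₀ ℂ) →ₗ[ℂ] (ι × List κ →₀ ℂ) :=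
  Finsupp.linearCombination ℂ fun p => ∑ n ∈ Finset.range (p.2.length + 1),
    Finsupp.single (p.1, p.2.take n) (D.germ y (p.1, p.2.drop n) y')

lemma shift_mem_wordsLT (y y' : X) {n : ℕ} {a : ι × List κ →₀ ℂ} (ha : a ∈ wordsLT ι κ n) :
    D.shift y y' a ∈ wordsLT ι κ n := by
  refine linearCombination_mem_wordsLT (fun p hp => ?_) ha
  refine Submodule.sum_mem _ fun m _ => Finsupp.single_mem_supported ℂ _ ?_
  exact (List.length_take_le' _ _).trans_lt hp

variable {D} in
lemma eval_shift {y y' : X} {r r' : ℝ} (hr : D.IsRadius y r) (hr' : D.IsRadius y' r')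
    (hy' : y' ∈ D.near y r) {x : X} (hx : x ∈ D.near y r) (hx' : x ∈ D.near y' r')
    (a : ι × List κ →₀ ℂ) : D.eval y' (D.shift y y' a) x = D.eval y a x := by
  induction a using Finsupp.induction_linear with
  | zero => simp
  | add a b ha hb => simp only [map_add, Pi.add_apply, ha, hb]
  | single p c =>
    have h := wordIntegral_changeBase (D.ν p.1) (hr p.1) (hr' p.1) (hy'.2 p.1) p.2 (D.u p.1 x)
      ⟨hx.2 p.1, hx'.2 p.1⟩
    simp only [eval, shift, Finsupp.linearCombination_single, map_smul, map_sum, Pi.smul_apply,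
      Finset.sum_apply]
    rw [germ, h]
    rfl

/-- The coefficients of the symbol after a change of base point from `y` to `y'`. -/
lemma symbol_shift (y y' : X) (a : ι × List κ →₀ ℂ) (J : List μ) :
    symbol D.α (D.shift y y' a) J = Finsupp.linearCombination ℂ (fun p : ι × List κ =>
      D.germ y (p.1, p.2.drop J.length) y' * substCoeff (D.α p.1) (p.2.take J.length) J) a := by
  induction a using Finsupp.induction_linear with
  | zero => simp
  | add a b ha hb => simp only [map_add, Pi.add_apply, ha, hb]
  | single p c =>
    simp only [symbol, shift, Finsupp.linearCombination_single, map_smul, map_sum, Pi.smul_apply,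
      Finset.sum_apply, smul_eq_mul]
    congr 1
    refine Finset.sum_eq_single J.length (fun n hn hne => ?_) fun hJ => ?_
    · rw [substCoeff_eq_zero, mul_zero]
      rw [Finset.mem_range] at hn
      rw [List.length_take]
      omega
    · rw [substCoeff_eq_zero, mul_zero]
      rw [Finset.mem_range] at hJ
      rw [List.length_take]
      omega

/-- A change of base point does not affect the leading part of the symbol. -/
lemma symbol_shift_of_length {y y' : X} {r : ℝ} (hr : D.IsRadius y r)
    (hy' : y' ∈ D.near y r) {a : ι × List κ →₀ ℂ} {J : List μ}
    (ha : a ∈ wordsLT ι κ (J.length + 1)) :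
    symbol D.α (D.shift y y' a) J = symbol D.α a J := by
  rw [symbol_shift, symbol, Finsupp.linearCombination_apply, Finsupp.linearCombination_apply,
    Finsupp.sum, Finsupp.sum, Finset.sum_apply]
  refine Finset.sum_congr rfl fun p hp => ?_
  have hp' : p.2.length ≤ J.length := Nat.lt_succ_iff.1 ((Finsupp.mem_supported ℂ a).1 ha hp)
  rw [Pi.smul_apply, List.drop_eq_nil_of_le hp', List.take_of_length_le hp', germ_nil hr _ hy',
    one_mul]

/-- The next to leading part of the symbol, as a function of the base point `y'`, has a
differential given by the leading part. -/
lemma hasDifferential_symbol_shift [Finite ι] {y : X} (hy : y ∈ Y) {a : ι × List κ →₀ ℂ}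
    {J : List μ} (ha : a ∈ wordsLT ι κ (J.length + 2)) :
    HasDifferential (fun y' => symbol D.α (D.shift y y' a) J) y
      (∑ j, symbol D.α a (J ++ [j]) • D.h j ⟨y, hy⟩) := by
  obtain ⟨r, hr0, hr⟩ := D.exists_isRadius hy
  have hyr : y ∈ D.near y r := mem_of_mem_nhds (D.near_mem_nhds hy hr0)
  have hword : ∀ (i : ι) (v : List κ), v.length ≤ 1 →
      HasDifferential (D.germ y (i, v)) y
        (∑ j, substCoeff (D.α i) v [j] • D.h j ⟨y, hy⟩) := by
    rintro i (_ | ⟨k, v⟩) hv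
    · simp only [substCoeff, zero_smul, Finset.sum_const_zero]
      refine (HasDifferential.const 1 y).congr_of_eventuallyEq ?_
      filter_upwards [D.near_mem_nhds hy hr0] with x hx using germ_nil hr i hx
    · have hv' : v = [] := by
        rw [List.length_cons] at hv
        exact List.length_eq_zero_iff.1 (by omega)
      subst hv'
      simpa only [germ_nil hr i hyr, one_smul, substCoeff, mul_one] using
        hasDifferential_germ hr i k [] hyr
  have hfun : (fun y' => symbol D.α (D.shift y y' a) J) = ∑ p ∈ a.support,
      (a p * substCoeff (D.α p.1) (p.2.take J.length) J) •
        D.germ y (p.1, p.2.drop J.length) := by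
    ext y'
    rw [symbol_shift, Finsupp.linearCombination_apply, Finsupp.sum, Finset.sum_apply]
    refine Finset.sum_congr rfl fun p _ => ?_
    rw [Pi.smul_apply, smul_eq_mul, smul_eq_mul]
    ring
  have hlen : ∀ p ∈ a.support, (p.2.drop J.length).length ≤ 1 := by
    intro p hp
    have : p.2.length < J.length + 2 := (Finsupp.mem_supported ℂ a).1 ha hp
    rw [List.length_drop]
    omega
  have hsum : ∑ j, symbol D.α a (J ++ [j]) • D.h j ⟨y, hy⟩ = ∑ p ∈ a.support,
      (a p * substCoeff (D.α p.1) (p.2.take J.length) J) •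
        ∑ j, substCoeff (D.α p.1) (p.2.drop J.length) [j] • D.h j ⟨y, hy⟩ := by
    simp only [Finset.smul_sum]
    rw [Finset.sum_comm]
    refine Finset.sum_congr rfl fun j _ => ?_
    rw [symbol, Finsupp.linearCombination_apply, Finsupp.sum, Finset.sum_apply, Finset.sum_smul]
    refine Finset.sum_congr rfl fun p _ => ?_
    rw [Pi.smul_apply, substCoeff_append, smul_smul, smul_eq_mul, mul_assoc]
  rw [hfun, hsum]
  exact HasDifferential.sum fun p hp => (hword p.1 _ (hlen p hp)).const_smul _

end WordSystem
end HyperlogWeb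

namespace HyperlogWeb

open Filter Set Metric Asymptotics

/-! ### Relations between hyperlogarithms come from relations between symbols -/

namespace WordSystem

variable {E : Type*} [NormedAddCommGroup E] [NormedSpace ℂ E]
  {X : Type*} [TopologicalSpace X] [ChartedSpace E X] {Y : Set X}
  {ι κ μ : Type*} [Fintype μ] (D : WordSystem E Y ι κ μ)

/-- The combination `a` of iterated integrals with base point `y` vanishes as a germ at `y`. -/
def IsRelation (y : X) (a : ι × List κ →₀ ℂ) : Prop :=
  ∀ᶠ x in 𝓝 y, D.eval y a x = 0

variable {D}

lemma IsRelation.sub {y : X} {a b : ι × List κ →₀ ℂ} (ha : D.IsRelation y a)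
    (hb : D.IsRelation y b) : D.IsRelation y (a - b) := by
  filter_upwards [ha, hb] with x h1 h2
  rw [map_sub, Pi.sub_apply, h1, h2, sub_zero]

lemma contMDiffAt_eval {y : X} {r : ℝ} (hr : D.IsRadius y r) {x : X} (hx : x ∈ D.near y r)
    (a : ι × List κ →₀ ℂ) : ContMDiffAt 𝓘(ℂ, E) 𝓘(ℂ, ℂ) ω (D.eval y a) x := by
  induction a using Finsupp.induction_linear with
  | zero =>
    rw [map_zero]
    exact contMDiffAt_const (c := (0 : ℂ))
  | add a b ha hb =>
    rw [map_add]
    exact ha.add hb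
  | single p c =>
    have h1 : ContDiffAt ℂ ω (wordIntegral (D.ν p.1) (D.u p.1 y) p.2) (D.u p.1 x) :=
      ((differentiableOn_wordIntegral (D.ν p.1) (hr p.1) p.2).analyticAt
        (isOpen_ball.mem_nhds (hx.2 p.1))).contDiffAt
    have h2 : ContMDiffAt 𝓘(ℂ, E) 𝓘(ℂ, ℂ) ω (D.germ y p) x :=
      h1.contMDiffAt.comp x (D.contMDiffAt p.1 x hx.1)
    simp only [eval, Finsupp.linearCombination_single]
    exact contMDiffAt_const.mul h2

variable [Finite ι] [IsManifold 𝓘(ℂ, E) ω X]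

/-- Identity principle, uniformly in the combination `a`. -/
lemma eventually_isRelation_iff {y : X} (hy : y ∈ Y) : ∀ᶠ y' in 𝓝 y, ∀ a : ι × List κ →₀ ℂ,
    (∀ᶠ x in 𝓝 y', D.eval y a x = 0) ↔ D.IsRelation y a := by
  obtain ⟨r, hr0, hr⟩ := D.exists_isRadius hy
  obtain ⟨ρ, hρ, hball⟩ := Metric.eventually_nhds_iff_ball.1
    ((eventually_comp_chartAt_symm (E := E) y (p := (· ∈ D.near y r)) (D.near_mem_nhds hy hr0)).and
      ((chartAt E y).open_target.mem_nhds (mem_chart_target E y)))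
  have han : ∀ a, AnalyticOnNhd ℂ (D.eval y a ∘ (chartAt E y).symm)
      (ball (chartAt E y y) ρ) := fun a p hp =>
    analyticAt_comp_chartAt_symm y (hball p hp).2 (contMDiffAt_eval hr (hball p hp).1 a)
  -- a combination which vanishes near a point of the ball vanishes near all of its points
  have key : ∀ a, ∀ p ∈ ball (chartAt E y y) ρ, ∀ q ∈ ball (chartAt E y y) ρ,
      (∀ᶠ x in 𝓝 ((chartAt E y).symm p), D.eval y a x = 0) →
        ∀ᶠ x in 𝓝 ((chartAt E y).symm q), D.eval y a x = 0 := by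
    intro a p hp q hq h
    have h1 := ((chartAt E y).continuousAt_symm (hball p hp).2).eventually h
    have h2 := (han a).eqOn_zero_of_preconnected_of_eventuallyEq_zero
      (convex_ball _ _).isPreconnected hp h1
    have hq' := (chartAt E y).map_target (hball q hq).2
    have h3 := ((chartAt E y).continuousAt hq').eventually (p := (· ∈ ball (chartAt E y y) ρ))
      (by rw [(chartAt E y).right_inv (hball q hq).2]; exact isOpen_ball.mem_nhds hq)
    filter_upwards [h3, (chartAt E y).open_source.mem_nhds hq'] with x hx1 hx2
    simpa [(chartAt E y).left_inv hx2] using h2 hx1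
  have hy0 : (chartAt E y).symm (chartAt E y y) = y :=
    (chartAt E y).left_inv (mem_chart_source E y)
  refine eventually_of_eventually_comp_chartAt_symm (E := E) y ?_
  filter_upwards [ball_mem_nhds (chartAt E y y) hρ] with p hp a
  have hc := mem_ball_self (x := chartAt E y y) hρ
  constructor
  · intro h
    have h1 := key a p hp _ hc h
    rwa [hy0] at h1
  · intro h
    exact key a _ hc p hp (by rwa [hy0])

/-- Relations are transported between neighbouring base points, in both directions, without a
change of the leading part of the symbol. -/
lemma eventually_isRelation_shift {y : X} (hy : y ∈ Y) : ∀ᶠ y' in 𝓝 y, ∀ a : ι × List κ →₀ ℂ,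
    (D.IsRelation y a → D.IsRelation y' (D.shift y y' a)) ∧
    (D.IsRelation y' a → D.IsRelation y (D.shift y' y a)) ∧
    ∀ J : List μ, a ∈ wordsLT ι κ (J.length + 1) →
      symbol D.α (D.shift y y' a) J = symbol D.α a J ∧
      symbol D.α (D.shift y' y a) J = symbol D.α a J := by
  obtain ⟨r, hr0, hr⟩ := D.exists_isRadius hy
  have hr2 : 0 < r / 2 := half_pos hr0
  filter_upwards [eventually_isRelation_iff (D := D) hy, D.near_mem_nhds hy hr2,
    eventually_eventually_nhds.2 (D.near_mem_nhds hy hr2)] with y' hiff hy' hnear a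
  have hy'Y : y' ∈ Y := hy'.1
  have hr' : D.IsRadius y' (r / 2) := fun i =>
    (hr i).mono_left (ball_subset_ball' (by linarith [mem_ball.1 (hy'.2 i)]))
  have hyy' : y ∈ D.near y' (r / 2) := ⟨hy, fun i => mem_ball_comm.1 (hy'.2 i)⟩
  have hmono : D.near y (r / 2) ⊆ D.near y r := fun x hx =>
    ⟨hx.1, fun i => ball_subset_ball (half_le_self hr0.le) (hx.2 i)⟩
  refine ⟨fun h => ?_, fun h => ?_, fun J hJ =>
    ⟨D.symbol_shift_of_length hr (hmono hy') hJ, D.symbol_shift_of_length hr' hyy' hJ⟩⟩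
  · filter_upwards [(hiff a).2 h, hnear, D.near_mem_nhds hy'Y hr2] with x h1 h2 h3
    rw [eval_shift hr hr' (hmono hy') (hmono h2) h3, h1]
  · refine (hiff _).1 ?_
    filter_upwards [h, hnear, D.near_mem_nhds hy'Y hr2] with x h1 h2 h3
    rw [eval_shift hr' hr hyy' h3 (hmono h2), h1]

/-- If relations in words of length less than `n` have zero symbol, then so do those in words of
length at most `n` of which the leading part of the symbol is zero. -/
lemma symbol_eq_zero_of_leading {n : ℕ} {y : X} (hy : y ∈ Y)
    (ih : ∀ a ∈ wordsLT ι κ n, D.IsRelation y a → symbol D.α a = 0)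
    {a : ι × List κ →₀ ℂ} (ha : a ∈ wordsLT ι κ (n + 1)) (hrel : D.IsRelation y a)
    (hlead : ∀ J : List μ, J.length = n → symbol D.α a J = 0) : symbol D.α a = 0 := by
  classical
  set low := a.filter fun p => p.2.length < n
  set top := a.filter fun p => ¬ p.2.length < n
  have hsplit : low + top = a := Finsupp.filter_add_filter_not a _
  have hlow : low ∈ wordsLT ι κ n := by
    rw [wordsLT, Finsupp.mem_supported]
    intro p hp
    rw [Finsupp.support_filter, Finset.mem_coe, Finset.mem_filter] at hp
    exact hp.2
  have htoplen : ∀ p ∈ top.support, p.2.length = n := by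
    intro p hp
    rw [Finsupp.support_filter, Finset.mem_filter] at hp
    have h1 : p.2.length < n + 1 := (Finsupp.mem_supported ℂ a).1 ha hp.1
    omega
  have htopmem : top ∈ wordsLT ι κ (n + 1) := by
    rw [wordsLT, Finsupp.mem_supported]
    intro p hp
    exact (htoplen p hp).trans_lt (Nat.lt_succ_self n)
  have htop : symbol D.α top = 0 := by
    ext J
    by_cases hJ : J.length = n
    · have h1 : symbol D.α low J = 0 := symbol_eq_zero_of_length D.α fun p hp => by
        have h2 : p.2.length < n := (Finsupp.mem_supported ℂ low).1 hlow hp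
        omega
      have h2 := hlead J hJ
      rwa [← hsplit, map_add, Pi.add_apply, h1, zero_add] at h2
    · exact symbol_eq_zero_of_length D.α fun p hp h => hJ (h ▸ htoplen p hp)
  have hlowrel : D.IsRelation y low := by
    have := hrel.sub (D.eval_eventually_eq_zero (n + 1) top htopmem htop y hy)
    rwa [← hsplit, add_sub_cancel_right] at this
  rw [← hsplit, map_add, htop, add_zero]
  exact ih low hlow hlowrel

/-- A relation between pulled-back hyperlogarithms has zero symbol. -/
theorem IsRelation.symbol_eq_zero (hconn : IsPreconnected Y) (n : ℕ) :
    ∀ y ∈ Y, ∀ a ∈ wordsLT ι κ n, D.IsRelation y a → symbol D.α a = 0 := by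
  induction n with
  | zero =>
    intro y _ a ha _
    have : a = 0 := by simpa [wordsLT] using ha
    rw [this, map_zero]
  | succ n ih =>
    intro y₀ hy₀ a₀ ha₀ hrel₀
    refine symbol_eq_zero_of_leading hy₀ (ih y₀ hy₀) ha₀ hrel₀ ?_
    rcases n with _ | n
    · intro J hJ
      rw [List.length_eq_zero_iff.1 hJ, ← D.eval_self hy₀]
      exact hrel₀.self_of_nhds
    -- relations with the same leading symbol exist at all points of `Y`
    have hex : ∀ y : X, ∃ a ∈ wordsLT ι κ (n + 2), y ∈ Y → D.IsRelation y a ∧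
        ∀ J : List μ, J.length = n + 1 → symbol D.α a J = symbol D.α a₀ J := by
      intro y
      by_cases hy : y ∈ Y
      · have := (iff_of_isPreconnected hconn (P := fun y => ∃ a ∈ wordsLT ι κ (n + 2),
          D.IsRelation y a ∧ ∀ J : List μ, J.length = n + 1 → symbol D.α a J = symbol D.α a₀ J)
          (fun y hy => ?_) hy₀ hy).1 ⟨a₀, ha₀, hrel₀, fun _ _ => rfl⟩
        · obtain ⟨a, ha, h⟩ := this
          exact ⟨a, ha, fun _ => h⟩
        · filter_upwards [eventually_isRelation_shift (D := D) hy] with y' hy'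
          constructor
          · rintro ⟨a, ha, h1, h2⟩
            exact ⟨_, D.shift_mem_wordsLT y' y ha, (hy' a).2.1 h1, fun J hJ =>
              ((hy' a).2.2 J (hJ ▸ ha)).2.trans (h2 J hJ)⟩
          · rintro ⟨a, ha, h1, h2⟩
            exact ⟨_, D.shift_mem_wordsLT y y' ha, (hy' a).1 h1, fun J hJ =>
              ((hy' a).2.2 J (hJ ▸ ha)).1.trans (h2 J hJ)⟩
      · exact ⟨a₀, ha₀, fun h => absurd h hy⟩
    choose b hb hbrel using hex
    -- their next to leading symbols form single-valued functions, with differentials given by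
    -- the leading symbol
    have hdiff : ∀ J : List μ, J.length = n → ∀ y : Y,
        HasDifferential (fun y' => symbol D.α (b y') J) (y : X)
          (∑ j, symbol D.α a₀ (J ++ [j]) • D.h j y) := by
      rintro J rfl ⟨y, hy⟩
      have h1 := D.hasDifferential_symbol_shift hy (J := J) (hb y)
      have h2 : ∀ j, symbol D.α (b y) (J ++ [j]) = symbol D.α a₀ (J ++ [j]) := fun j =>
        (hbrel y hy).2 _ (by simp)
      simp only [h2] at h1
      -- `b y'` and the transport of `b y` have the same leading symbol, so the same symbol
      refine h1.congr_of_eventuallyEq ?_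
      filter_upwards [eventually_isRelation_shift (D := D) hy, D.isOpen.mem_nhds hy]
        with y' hy' hy'Y
      have h3 : symbol D.α (b y' - D.shift y y' (b y)) = 0 := by
        refine symbol_eq_zero_of_leading hy'Y (ih y' hy'Y)
          (Submodule.sub_mem _ (hb y') (D.shift_mem_wordsLT y y' (hb y)))
          ((hbrel y' hy'Y).1.sub ((hy' _).1 (hbrel y hy).1)) fun J' hJ' => ?_
        rw [map_sub, Pi.sub_apply, ((hy' (b y)).2.2 J' (hJ' ▸ hb y)).1, (hbrel y' hy'Y).2 J' hJ',
          (hbrel y hy).2 J' hJ', sub_self]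
      rw [map_sub, sub_eq_zero] at h3
      rw [h3]
    intro J hJ
    obtain ⟨J', j, rfl⟩ := (List.eq_nil_or_concat J).resolve_left (by
      rintro rfl
      simp at hJ)
    rw [List.concat_eq_append] at hJ ⊢
    exact congrFun (D.eq_zero_of_exact _ _ (hdiff J' (by simpa using hJ))) j

end WordSystem
end HyperlogWeb

namespace HyperlogWeb

open Filter Set

/-! ### Tensors of logarithmic forms as combinations of words -/

variable {E : Type*} [NormedAddCommGroup E] [NormedSpace ℂ E]
  {X : Type*} [TopologicalSpace X] [ChartedSpace E X] {Z : Set X} {d s m : ℕ}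
  {U : Fin d → X → ProjSpace 1}

/-- The `WordSystem` attached to maps `U i` to the projective line, to bases of the spaces of
logarithmic forms, and to a basis of the space `H` of 1-forms on the complement of `Z`. -/
noncomputable def webWordSystem [IsManifold 𝓘(ℂ, E) ω X] [CompactSpace X] [ConnectedSpace X]
    (hZ : IsHypersurface E Z) (hU : ∀ i, IsHolomorphicToProj E (U i))
    (hinf : ∀ i, infPt ∈ branchLocus Zᶜ (U i)) (hfin : ∀ i, (branchLocus Zᶜ (U i)).Finite)
    (ν : ∀ i, Module.Basis (Fin s) ℂ (LogFormsOf Zᶜ (U i)))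
    (b : Module.Basis (Fin m) ℂ (totalForms E Zᶜ U)) :
    WordSystem E Zᶜ (Fin d) (Fin s) (Fin m) where
  u i x := affCoord (U i x)
  S i := finPart (branchLocus Zᶜ (U i))
  ν i := ν i
  α i k j := b.repr (pullbackTo E Zᶜ U i (ν i k)) j
  h j := (b j).1
  isOpen := hZ.isOpen_compl
  isClosed i := (finite_finPart (hfin i)).isClosed
  notMem i _ hy := affCoord_notMem_finPart (hinf i) hy
  contMDiffAt i _ hy := (hU i).contMDiffAt_affCoord (hinf i) hy
  pullback_eq i k y := by
    have h := congrArg (fun f : totalForms E Zᶜ U => (f : OneForm E Zᶜ) y)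
      (b.sum_repr (pullbackTo E Zᶜ U i (ν i k)))
    simp only [Submodule.coe_sum, Submodule.coe_smul, Finset.sum_apply, Pi.smul_apply] at h
    exact h.symm
  eq_zero_of_exact t φ hφ := by
    have h : ∑ j, t j • b j = 0 := by
      refine Subtype.ext (eq_zero_of_hasMFDerivAt hZ hU hinf hfin (∑ j, t j • b j).2
        (φ := φ) fun y => ?_)
      simp only [Submodule.coe_sum, Submodule.coe_smul, Finset.sum_apply, Pi.smul_apply]
      exact hφ y
    rw [← b.repr_sum_self t, h, map_zero, Finsupp.coe_zero]

/-- The combination of words attached to `∑ i, τ i`, for tensors `τ i` expanded in the bases of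
pure tensors given by the `ν i`. -/
noncomputable def toWords {V : Fin d → Type*} [∀ i, AddCommGroup (V i)] [∀ i, Module ℂ (V i)]
    (ν : ∀ i, Module.Basis (Fin s) ℂ (V i)) {n : ℕ} (c : Fin d → ℂ) (τ : ∀ i, ⨂[ℂ]^n (V i)) :
    Fin d × List (Fin s) →₀ ℂ :=
  ∑ i, ∑ w, Finsupp.single (i, List.ofFn w)
    (c i * (Basis.piTensorProduct fun _ : Fin n => ν i).repr (τ i) w)

section Words

variable {V : Fin d → Type*} [∀ i, AddCommGroup (V i)] [∀ i, Module ℂ (V i)]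
  (ν : ∀ i, Module.Basis (Fin s) ℂ (V i)) {n : ℕ} (c : Fin d → ℂ) (τ : ∀ i, ⨂[ℂ]^n (V i))

lemma length_of_mem_support_toWords {p : Fin d × List (Fin s)}
    (hp : p ∈ (toWords ν c τ).support) : p.2.length = n := by
  by_contra hne
  rw [Finsupp.mem_support_iff, toWords, Finsupp.finsetSum_apply] at hp
  refine hp (Finset.sum_eq_zero fun i _ => ?_)
  rw [Finsupp.finsetSum_apply]
  refine Finset.sum_eq_zero fun w _ => Finsupp.single_eq_of_ne ?_
  rintro rfl
  exact hne (List.length_ofFn)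

lemma toWords_mem_wordsLT : toWords ν c τ ∈ wordsLT (Fin d) (Fin s) (n + 1) :=
  (Finsupp.mem_supported ℂ _).2 fun _ hp =>
    (length_of_mem_support_toWords ν c τ hp).trans_lt (Nat.lt_succ_self n)

lemma eq_sum_tprod (i : Fin d) : τ i = ∑ w : Fin n → Fin s,
    (Basis.piTensorProduct fun _ : Fin n => ν i).repr (τ i) w •
      PiTensorProduct.tprod ℂ (fun t => ν i (w t)) := by
  conv_lhs => rw [← (Basis.piTensorProduct fun _ : Fin n => ν i).sum_repr (τ i)]
  simp only [Basis.piTensorProduct_apply]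

/-- The symbol of `toWords ν c τ` is the family of coordinates of `∑ i, c i • (f i)^⊗n (τ i)`. -/
lemma symbol_toWords_ofFn {W : Type*} [AddCommMonoid W] [Module ℂ W]
    (b : Module.Basis (Fin m) ℂ W) (f : ∀ i, V i →ₗ[ℂ] W) (J : Fin n → Fin m) :
    symbol (fun i k j => b.repr (f i (ν i k)) j) (toWords ν c τ) (List.ofFn J) =
      (Basis.piTensorProduct fun _ : Fin n => b).repr
        (∑ i, c i • PiTensorProduct.map (fun _ => f i) (τ i)) J := by
  simp only [toWords, symbol, map_sum, Finsupp.linearCombination_single, map_smul,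
    Finset.sum_apply, Pi.smul_apply, Finsupp.finsetSum_apply, Finsupp.smul_apply]
  refine Finset.sum_congr rfl fun i _ => ?_
  conv_rhs => rw [eq_sum_tprod ν τ i]
  simp only [map_sum, map_smul, Finsupp.finsetSum_apply, Finsupp.smul_apply,
    PiTensorProduct.map_tprod, Basis.piTensorProduct_repr_tprod_apply, Finset.mul_sum,
    smul_eq_mul, substCoeff_ofFn, mul_assoc]

lemma symbol_toWords_eq_zero_iff {W : Type*} [AddCommMonoid W] [Module ℂ W]
    (b : Module.Basis (Fin m) ℂ W) (f : ∀ i, V i →ₗ[ℂ] W) :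
    symbol (fun i k j => b.repr (f i (ν i k)) j) (toWords ν c τ) = 0 ↔
      ∑ i, c i • PiTensorProduct.map (fun _ => f i) (τ i) = 0 := by
  constructor
  · intro h
    refine (Basis.piTensorProduct fun _ : Fin n => b).ext_elem fun J => ?_
    rw [← symbol_toWords_ofFn, h, map_zero]
    rfl
  · intro h
    ext J
    by_cases hJ : n = J.length
    · subst hJ
      have h1 := symbol_toWords_ofFn ν c τ b f J.get
      rw [h, List.ofFn_get] at h1
      simpa using h1
    · exact symbol_eq_zero_of_length _ fun p hp h' =>
        hJ ((length_of_mem_support_toWords ν c τ hp).symm.trans h')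

end Words

lemma eval_toWords [IsManifold 𝓘(ℂ, E) ω X] [CompactSpace X] [ConnectedSpace X]
    (hZ : IsHypersurface E Z) (hU : ∀ i, IsHolomorphicToProj E (U i))
    (hinf : ∀ i, infPt ∈ branchLocus Zᶜ (U i)) (hfin : ∀ i, (branchLocus Zᶜ (U i)).Finite)
    (ν : ∀ i, Module.Basis (Fin s) ℂ (LogFormsOf Zᶜ (U i)))
    (b : Module.Basis (Fin m) ℂ (totalForms E Zᶜ U)) {n : ℕ} (c : Fin d → ℂ)
    (τ : ∀ i, ⨂[ℂ]^n (LogFormsOf Zᶜ (U i))) (y x : X) :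
    (webWordSystem hZ hU hinf hfin ν b).eval y (toWords ν c τ) x =
      ∑ i, c i * hyperlog (affCoord (U i y)) (τ i) (affCoord (U i x)) := by
  simp only [toWords, WordSystem.eval, map_sum, Finsupp.linearCombination_single,
    Finset.sum_apply, Pi.smul_apply]
  refine Finset.sum_congr rfl fun i _ => ?_
  conv_rhs => rw [eq_sum_tprod ν τ i, hyperlog_sum_smul, Finset.mul_sum]
  refine Finset.sum_congr rfl fun w _ => ?_
  rw [hyperlog_tprod, smul_eq_mul, mul_assoc]
  rfl

instance finite_totalForms {Y : Set X} [∀ i, Module.Finite ℂ (LogFormsOf Y (U i))] :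
    Module.Finite ℂ (totalForms E Y U) := by
  unfold totalForms
  infer_instance

instance free_totalForms {Y : Set X} : Module.Free ℂ (totalForms E Y U) :=
  -- the group structure is rebuilt from the scalars, so that its additive monoid is
  -- definitionally that of `Submodule`
  letI := Module.addCommMonoidToAddCommGroup ℂ (M := totalForms E Y U)
  Module.Free.of_divisionRing ℂ (totalForms E Y U)

/-- For arbitrary tensors `τ i` of logarithmic forms, the
combinations of pulled-back hyperlogarithms vanish as germs exactly when their symbols do. -/
theorem tfae_symbol_hyperlog [IsManifold 𝓘(ℂ, E) ω X] [CompactSpace X] [ConnectedSpace X]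
    (hZ : IsHypersurface E Z) (hU : ∀ i, IsHolomorphicToProj E (U i))
    (hinf : ∀ i, infPt ∈ branchLocus Zᶜ (U i)) (hfin : ∀ i, (branchLocus Zᶜ (U i)).Finite)
    (ν : ∀ i, Module.Basis (Fin s) ℂ (LogFormsOf Zᶜ (U i))) {n : ℕ} (c : Fin d → ℂ)
    (τ : ∀ i, ⨂[ℂ]^n (LogFormsOf Zᶜ (U i))) :
    List.TFAE [
      ∑ i, c i • pullbackTensor E Zᶜ U i n (τ i) = 0,
      ∃ y ∈ Zᶜ, (fun x => ∑ i, c i *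
        hyperlog (affCoord (U i y)) (τ i) (affCoord (U i x))) =ᶠ[𝓝 y] 0,
      ∀ y ∈ Zᶜ, (fun x => ∑ i, c i *
        hyperlog (affCoord (U i y)) (τ i) (affCoord (U i x))) =ᶠ[𝓝 y] 0] := by
  have : ∀ i, Module.Finite ℂ (LogFormsOf Zᶜ (U i)) := fun i => Module.Finite.of_basis (ν i)
  let b := Module.finBasis ℂ (totalForms E Zᶜ U)
  let D := webWordSystem hZ hU hinf hfin ν b
  have hsymbol : symbol D.α (toWords ν c τ) = 0 ↔
      ∑ i, c i • pullbackTensor E Zᶜ U i n (τ i) = 0 :=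
    symbol_toWords_eq_zero_iff ν c τ b (pullbackTo E Zᶜ U)
  have heval : ∀ y, (fun x => ∑ i, c i *
      hyperlog (affCoord (U i y)) (τ i) (affCoord (U i x))) = D.eval y (toWords ν c τ) :=
    fun y => funext fun x => (eval_toWords hZ hU hinf hfin ν b c τ y x).symm
  simp only [heval, ← hsymbol]
  have hmem : toWords ν c τ ∈ wordsLT (Fin d) (Fin s) (n + 1) := toWords_mem_wordsLT ν c τ
  tfae_have 1 → 3 := fun h => D.eval_eventually_eq_zero (n + 1) _ hmem h
  tfae_have 3 → 2 := fun h => by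
    obtain ⟨y, hy⟩ := hZ.dense_compl.nonempty
    exact ⟨y, hy, h y hy⟩
  tfae_have 2 → 1 := fun ⟨y, hy, h⟩ =>
    WordSystem.IsRelation.symbol_eq_zero hZ.isPreconnected_compl (n + 1) y hy _ hmem h
  tfae_finish

end HyperlogWeb

theorem mainTheorem5
    {E : Type*} [NormedAddCommGroup E] [NormedSpace ℂ E]
    {X : Type*} [TopologicalSpace X] [ChartedSpace E X]
    (hX : IsProjectiveManifold E X)
    (Z : Set X) (hZ : IsHypersurface E Z)
    (d s : ℕ) (hs : 1 ≤ s)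
    (U : Fin d → X → ProjSpace 1)
    (hU : ∀ i, IsHolomorphicToProj E (U i))
    (hinf : ∀ i, infPt ∈ branchLocus Zᶜ (U i))
    (hcard : ∀ i, (branchLocus Zᶜ (U i)).encard = s + 1)
    (hsub : ∀ i, ∀ y ∈ Zᶜ, Function.Surjective (dAff E (U i) y))
    (htrans : ∀ i j, i ≠ j → ∀ y ∈ Zᶜ,
      LinearIndependent ℂ ![dAff E (U i) y, dAff E (U j) y])
    (ν : ∀ i, Module.Basis (Fin s) ℂ (LogFormsOf Zᶜ (U i)))
    (c : Fin d → ℂ) :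
    List.TFAE [
      ∑ i, c i • pullbackTensor E Zᶜ U i s (asym (ν i)) = 0,
      ∃ y ∈ Zᶜ, (fun x => ∑ i, c i *
        hyperlog (affCoord (U i y)) (asym (ν i)) (affCoord (U i x))) =ᶠ[𝓝 y] 0,
      ∀ y ∈ Zᶜ, (fun x => ∑ i, c i *
        hyperlog (affCoord (U i y)) (asym (ν i)) (affCoord (U i x))) =ᶠ[𝓝 y] 0] := by
  have := hX.isManifold
  have := hX.compact
  have := hX.connected
  have hfin : ∀ i, (branchLocus Zᶜ (U i)).Finite := fun i => by
    refine Set.finite_of_encard_le_coe (k := s + 1) ?_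
    rw [hcard i]
    norm_cast
  exact tfae_symbol_hyperlog hZ hU hinf hfin ν c fun i => asym (ν i)
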